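/- Let $A$ be an arbitrary (possibly non-unital) $C^*$-algebra with centre $Z(A)$. By an ideal we mean a norm-closed two-sided ideal; ideals and quotients by ideals are regarded as $C^*$-algebras. An ideal $I$ of $A$ is modular if $A/I$ is unital. A primitive ideal is the kernel of a nonzero irreducible $*$-representation on a Hilbert space; $\mathrm{Prim}(A)$ is the set of primitive ideals with the Jacobson (hull-kernel) topology. A $C^*$-algebra $B$ - has the centre-quotient property (CQ-property) if $Z(B/I)=(Z(B)+I)/I$ for every ideal $I$ of $B$; - is weakly central if (a) no modular maximal ideal of $B$ contains $Z(B)$, and (b) for all modular maximal ideals $M_1,M_2$ of $B$, $M_1\cap Z(B)=M_2\cap Z(B)$ implies $M_1=M_2$; - is quasi-central if no primitive ideal of $B$ contains $Z(B)$. Let $S_A$ be the set of non-modular primitive ideals of $A$, let $J_A$ be the intersection of all members of $S_A$ (with $J_A=A$ if $S_A=\emptyset$), and let $K_A$ be the ideal of $A$ generated by $Z(A)$. Then the following conditions are equivalent: (i) $A$ has the CQ-property. (ii) $A$ is weakly central. (iii) $S_A$ is a closed subset of $\mathrm{Prim}(A)$, $J_A=K_A$, and this ideal is a quasi-central and weakly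 central $C^*$-algebra. (iv) There is an ideal $J$ of $A$ which is weakly central (as a $C^*$-algebra) such that all primitive ideals of $A$ that contain $J$ are non-modular. (v) There is an ideal $J$ of $A$ such that both $J$ and $A/J$ have the CQ-property and $Z(A/J)=(Z(A)+J)/J$. -/

import Mathlib

universe u

/-- An ideal of a (possibly non-unital) C⋆-algebra: a norm-closed two-sided ideal. -/
structure ClosedIdeal (A : Type u) [NonUnitalCStarAlgebra A] extends Submodule ℂ A where
  mul_mem_left' : ∀ (a : A) {x : A}, x ∈ carrier → a * x ∈ carrier
  mul_mem_right' : ∀ (a : A) {x : A}, x ∈ carrier → x * a ∈ carrier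
  isClosed' : IsClosed carrier

namespace ClosedIdeal

section Basic

variable {A : Type u} [NonUnitalCStarAlgebra A]

instance : SetLike (ClosedIdeal A) A where
  coe I := I.carrier
  coe_injective I J h := by
    cases I; cases J; congr; exact SetLike.coe_injective h

instance : PartialOrder (ClosedIdeal A) := PartialOrder.ofSetLike (ClosedIdeal A) A

instance : NonUnitalSubringClass (ClosedIdeal A) A where
  add_mem {I} _ _ ha hb := I.toSubmodule.add_mem ha hb
  zero_mem I := I.toSubmodule.zero_mem
  neg_mem {I} _ ha := I.toSubmodule.neg_mem ha
  mul_mem {I} a _ _ hb := I.mul_mem_left' a hb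

instance : SMulMemClass (ClosedIdeal A) ℂ A where
  smul_mem {I} c _ ha := I.toSubmodule.smul_mem c ha

theorem mul_mem_left (I : ClosedIdeal A) (a : A) {x : A} (hx : x ∈ I) : a * x ∈ I :=
  I.mul_mem_left' a hx

theorem mul_mem_right (I : ClosedIdeal A) (a : A) {x : A} (hx : x ∈ I) : x * a ∈ I :=
  I.mul_mem_right' a hx

instance isClosed (I : ClosedIdeal A) : IsClosed (I : Set A) := I.isClosed'

instance isClosed_toSubmodule (I : ClosedIdeal A) : IsClosed (I.toSubmodule : Set A) :=
  I.isClosed'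

theorem mem_toSubmodule {I : ClosedIdeal A} {a : A} : a ∈ I.toSubmodule ↔ a ∈ I := Iff.rfl

end Basic

/-! ### Closed ideals are self-adjoint, and are C⋆-algebras -/

section SelfAdjoint

open Filter Topology

/-- Approximate units, in an order-free form. -/
theorem exists_approximateUnit (B : Type u) [NonUnitalCStarAlgebra B] :
    ∃ l : Filter B, l.NeBot ∧ (∀ m, Tendsto (fun e => m * e) l (𝓝 m)) ∧
      (∀ m, Tendsto (fun e => e * m) l (𝓝 m)) ∧
      ∀ᶠ e in l, (∃ b, e = star b * b) ∧ ‖e‖ ≤ 1 := by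
  let _ := CStarAlgebra.spectralOrder B
  have := CStarAlgebra.spectralOrderedRing B
  have h := CStarAlgebra.increasingApproximateUnit B
  refine ⟨_, h.neBot, h.tendsto_mul_left, h.tendsto_mul_right, ?_⟩
  filter_upwards [h.eventually_nonneg, h.eventually_norm] with e he he'
  exact ⟨CStarAlgebra.nonneg_iff_eq_star_mul_self.mp he, he'⟩

variable {A : Type u} [NonUnitalCStarAlgebra A]

theorem norm_sub_mul_le (y b : A) (h : ‖star b * b‖ ≤ 1) :
    ‖y - y * (star b * b)‖ ≤ ‖y‖ := by
  let _ := CStarAlgebra.spectralOrder (Unitization ℂ A)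
  have := CStarAlgebra.spectralOrderedRing (Unitization ℂ A)
  have h0 : (0 : Unitization ℂ A) ≤ ((star b * b : A) : Unitization ℂ A) := by
    rw [Unitization.inr_mul, Unitization.inr_star]
    exact star_mul_self_nonneg _
  have h1 : ‖((star b * b : A) : Unitization ℂ A)‖ ≤ 1 := by
    rwa [Unitization.norm_inr]
  have h2 := CStarAlgebra.mem_Icc_iff_norm_le_one.mpr ⟨h0, h1⟩
  have h3 := (CStarAlgebra.mem_Icc_iff_norm_le_one.mp
    (Set.sub_mem_Icc_zero_iff_right.mpr h2)).2
  calc ‖y - y * (star b * b)‖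
      = ‖(y : Unitization ℂ A) * (1 - ((star b * b : A) : Unitization ℂ A))‖ := by
        rw [← Unitization.norm_inr (𝕜 := ℂ), mul_sub, mul_one, Unitization.inr_sub,
          Unitization.inr_mul]
    _ ≤ ‖(y : Unitization ℂ A)‖ * ‖1 - ((star b * b : A) : Unitization ℂ A)‖ := norm_mul_le _ _
    _ ≤ ‖(y : Unitization ℂ A)‖ * 1 := by gcongr
    _ = ‖y‖ := by rw [mul_one, Unitization.norm_inr]

/-- The elements of a closed ideal whose adjoint also belongs to it. -/
def selfAdjointPart (I : ClosedIdeal A) : NonUnitalStarSubalgebra ℂ A where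
  carrier := {x | x ∈ I ∧ star x ∈ I}
  add_mem' ha hb := ⟨add_mem ha.1 hb.1, by rw [star_add]; exact add_mem ha.2 hb.2⟩
  zero_mem' := ⟨zero_mem I, by rw [star_zero]; exact zero_mem I⟩
  mul_mem' ha hb := ⟨mul_mem ha.1 hb.1, by rw [star_mul]; exact mul_mem hb.2 ha.2⟩
  smul_mem' c a ha := ⟨SMulMemClass.smul_mem c ha.1, by
    rw [star_smul]; exact SMulMemClass.smul_mem _ ha.2⟩
  star_mem' ha := ⟨ha.2, by rw [star_star]; exact ha.1⟩

instance isClosed_selfAdjointPart (I : ClosedIdeal A) :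
    IsClosed (I.selfAdjointPart : Set A) :=
  I.isClosed.inter (I.isClosed.preimage continuous_star)

theorem star_mem' (I : ClosedIdeal A) {a : A} (ha : a ∈ I) : star a ∈ I := by
  obtain ⟨l, hl, -, hr, hev⟩ := exists_approximateUnit I.selfAdjointPart
  let p : I.selfAdjointPart := ⟨a * star a, I.mul_mem_right _ ha, by
    rw [star_mul, star_star]; exact I.mul_mem_right _ ha⟩
  have key : Tendsto (fun e : I.selfAdjointPart => star a * (e : A)) l (𝓝 (star a)) := by
    have h0 : Tendsto (fun e : I.selfAdjointPart => 2 * ‖p - e * p‖) l (𝓝 0) := by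
      have := ((tendsto_const_nhds (x := p)).sub (hr p)).norm.const_mul 2
      simpa using this
    have h1 : Tendsto (fun e : I.selfAdjointPart => ‖star a * (e : A) - star a‖ * ‖star a * (e : A) - star a‖) l (𝓝 0) := by
      refine squeeze_zero' (Eventually.of_forall fun _ => by positivity) ?_ h0
      filter_upwards [hev] with e he
      obtain ⟨⟨b, hb⟩, hn⟩ := he
      have hsa : star (e : A) = e := by
        have : star e = e := by rw [hb, star_mul, star_star]
        exact congrArg Subtype.val this
      have hn' : ‖(e : A)‖ ≤ 1 := hn
      rw [← CStarRing.norm_star_mul_self]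
      have e1 : star (star a * (e : A) - star a) * (star a * (e : A) - star a)
          = (a * star a - e * (a * star a)) - (a * star a - e * (a * star a)) * e := by
        rw [star_sub, star_mul, star_star, hsa]
        noncomm_ring
      rw [e1]
      have e2 : ‖p - e * p‖ = ‖a * star a - e * (a * star a)‖ := rfl
      rw [e2]
      calc _ ≤ ‖a * star a - e * (a * star a)‖ + ‖(a * star a - e * (a * star a)) * e‖ :=
            norm_sub_le _ _
        _ ≤ ‖a * star a - e * (a * star a)‖ + ‖a * star a - e * (a * star a)‖ * ‖(e : A)‖ := by
            gcongr; exact norm_mul_le _ _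
        _ ≤ ‖a * star a - e * (a * star a)‖ + ‖a * star a - e * (a * star a)‖ * 1 := by gcongr
        _ = _ := by ring
    rw [tendsto_iff_norm_sub_tendsto_zero]
    have h2 := h1.sqrt
    simpa [Real.sqrt_mul_self] using h2
  exact I.isClosed.mem_of_tendsto key
    (Eventually.of_forall fun e => I.mul_mem_left _ e.2.1)

/-- Together with `NonUnitalStarSubalgebra.nonUnitalCStarAlgebra` this makes every closed ideal,
with the operations and the norm of the ambient algebra, a C⋆-algebra. -/
instance : StarMemClass (ClosedIdeal A) A where
  star_mem {I} _ ha := I.star_mem' ha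

end SelfAdjoint

/-! ### The quotient C⋆-algebra -/

section Quotient

open Filter Topology

variable {A : Type u} [NonUnitalCStarAlgebra A]

/-- The quotient `A / I`, with the quotient operations and the quotient norm. -/
def Quotient (I : ClosedIdeal A) : Type u := A ⧸ I.toSubmodule

/-- The canonical map `A → A / I`. -/
def proj (I : ClosedIdeal A) (a : A) : I.Quotient := Submodule.Quotient.mk a

variable (I : ClosedIdeal A)

theorem proj_surjective : Function.Surjective I.proj := Submodule.Quotient.mk_surjective _

theorem proj_eq_proj {a b : A} : I.proj a = I.proj b ↔ a - b ∈ I := Submodule.Quotient.eq _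

noncomputable instance : NormedAddCommGroup I.Quotient :=
  inferInstanceAs (NormedAddCommGroup (A ⧸ I.toSubmodule))

noncomputable instance : NormedSpace ℂ I.Quotient :=
  inferInstanceAs (NormedSpace ℂ (A ⧸ I.toSubmodule))

instance : CompleteSpace I.Quotient :=
  inferInstanceAs (CompleteSpace (A ⧸ I.toSubmodule))

instance : Mul I.Quotient where
  mul := _root_.Quotient.map₂ (· * ·) (by
    intro a a' ha b b' hb
    replace ha := I.toSubmodule.quotientRel_def.mp ha
    replace hb := I.toSubmodule.quotientRel_def.mp hb
    refine I.toSubmodule.quotientRel_def.mpr ?_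
    have : a * b - a' * b' = (a - a') * b + a' * (b - b') := by noncomm_ring
    rw [this]
    exact I.toSubmodule.add_mem (I.mul_mem_right _ ha) (I.mul_mem_left _ hb))

instance : Star I.Quotient where
  star := _root_.Quotient.map star (by
    intro a a' ha
    replace ha := I.toSubmodule.quotientRel_def.mp ha
    refine I.toSubmodule.quotientRel_def.mpr ?_
    rw [← star_sub]
    exact I.star_mem' ha)

theorem proj_mul (a b : A) : I.proj (a * b) = I.proj a * I.proj b := rfl
theorem proj_star (a : A) : I.proj (star a) = star (I.proj a) := rfl
theorem proj_add (a b : A) : I.proj (a + b) = I.proj a + I.proj b := rfl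
theorem proj_smul (c : ℂ) (a : A) : I.proj (c • a) = c • I.proj a := rfl
theorem proj_zero : I.proj 0 = 0 := rfl

theorem norm_proj_le (a : A) : ‖I.proj a‖ ≤ ‖a‖ := Submodule.Quotient.norm_mk_le _ _

theorem exists_norm_lt (x : I.Quotient) {ε : ℝ} (hε : 0 < ε) :
    ∃ a, I.proj a = x ∧ ‖a‖ < ‖x‖ + ε :=
  Submodule.Quotient.norm_mk_lt (S := I.toSubmodule) x hε

theorem quotient_norm_mul_le (x y : I.Quotient) : ‖x * y‖ ≤ ‖x‖ * ‖y‖ := by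
  have h : ∀ ε > 0, ‖x * y‖ ≤ (‖x‖ + ε) * (‖y‖ + ε) := by
    intro ε hε
    obtain ⟨a, rfl, ha⟩ := I.exists_norm_lt x hε
    obtain ⟨b, rfl, hb⟩ := I.exists_norm_lt y hε
    calc _ ≤ ‖a * b‖ := I.norm_proj_le _
      _ ≤ ‖a‖ * ‖b‖ := norm_mul_le _ _
      _ ≤ _ := by gcongr
  have hc : Tendsto (fun ε : ℝ => (‖x‖ + ε) * (‖y‖ + ε)) (𝓝[>] 0) (𝓝 (‖x‖ * ‖y‖)) := by
    have : Continuous fun ε : ℝ => (‖x‖ + ε) * (‖y‖ + ε) := by fun_prop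
    simpa using (this.tendsto 0).mono_left nhdsWithin_le_nhds
  refine ge_of_tendsto hc ?_
  filter_upwards [self_mem_nhdsWithin] with ε hε using h ε hε

noncomputable instance : NonUnitalNormedRing I.Quotient where
  __ := (inferInstance : NormedAddCommGroup I.Quotient)
  left_distrib x y z := by
    obtain ⟨a, rfl⟩ := I.proj_surjective x
    obtain ⟨b, rfl⟩ := I.proj_surjective y
    obtain ⟨c, rfl⟩ := I.proj_surjective z
    exact congrArg I.proj (mul_add a b c)
  right_distrib x y z := by
    obtain ⟨a, rfl⟩ := I.proj_surjective x
    obtain ⟨b, rfl⟩ := I.proj_surjective y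
    obtain ⟨c, rfl⟩ := I.proj_surjective z
    exact congrArg I.proj (add_mul a b c)
  zero_mul x := by
    obtain ⟨a, rfl⟩ := I.proj_surjective x
    exact congrArg I.proj (zero_mul a)
  mul_zero x := by
    obtain ⟨a, rfl⟩ := I.proj_surjective x
    exact congrArg I.proj (mul_zero a)
  mul_assoc x y z := by
    obtain ⟨a, rfl⟩ := I.proj_surjective x
    obtain ⟨b, rfl⟩ := I.proj_surjective y
    obtain ⟨c, rfl⟩ := I.proj_surjective z
    exact congrArg I.proj (mul_assoc a b c)
  norm_mul_le := I.quotient_norm_mul_le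

instance : StarRing I.Quotient where
  star_involutive x := by
    obtain ⟨a, rfl⟩ := I.proj_surjective x
    exact congrArg I.proj (star_star a)
  star_mul x y := by
    obtain ⟨a, rfl⟩ := I.proj_surjective x
    obtain ⟨b, rfl⟩ := I.proj_surjective y
    exact congrArg I.proj (star_mul a b)
  star_add x y := by
    obtain ⟨a, rfl⟩ := I.proj_surjective x
    obtain ⟨b, rfl⟩ := I.proj_surjective y
    exact congrArg I.proj (star_add a b)

theorem quotient_norm_mul_self_le (x : I.Quotient) : ‖x‖ * ‖x‖ ≤ ‖star x * x‖ := by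
  refine le_of_forall_pos_lt_add fun ε hε => ?_
  obtain ⟨a, rfl⟩ := I.proj_surjective x
  obtain ⟨c, hc, hcn⟩ := I.exists_norm_lt (star (I.proj a) * I.proj a) hε
  refine lt_of_le_of_lt ?_ hcn
  have hy : star a * a - c ∈ I := by
    rw [← I.proj_eq_proj, hc]; rfl
  obtain ⟨l, hl, hleft, -, hev⟩ := exists_approximateUnit I
  let y : I := ⟨star a * a - c, hy⟩
  have hlim : Tendsto (fun e : I => ‖c‖ + ‖y - y * e‖) l (𝓝 ‖c‖) := by
    have := ((tendsto_const_nhds (x := y)).sub (hleft y)).norm.const_add ‖c‖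
    simpa using this
  refine ge_of_tendsto hlim ?_
  filter_upwards [hev] with e he
  obtain ⟨⟨b, hb⟩, hn⟩ := he
  have hb' : (e : A) = star (b : A) * b := congrArg Subtype.val hb
  have hn' : ‖star (b : A) * (b : A)‖ ≤ 1 := by rw [← hb']; exact hn
  have hsa : star (e : A) = e := by rw [hb', star_mul, star_star]
  have h1 : ‖I.proj a‖ ≤ ‖a - a * e‖ := by
    have : I.proj a = I.proj (a - a * e) := by
      rw [I.proj_eq_proj, sub_sub_cancel]; exact I.mul_mem_left _ e.2
    rw [this]; exact I.norm_proj_le _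
  have h2 : star (a - a * (e : A)) * (a - a * e)
      = (star a * a - star a * a * e) - e * (star a * a - star a * a * e) := by
    rw [star_sub, star_mul, hsa]; noncomm_ring
  have h3 : ‖(star a * a - star a * a * e) - e * (star a * a - star a * a * e)‖
      ≤ ‖star a * a - star a * a * e‖ := by
    have := norm_sub_mul_le (star (star a * a - star a * a * (e : A))) (b : A) hn'
    rw [← hb', norm_star, ← norm_star, star_sub, star_mul, star_star, hsa] at this
    exact this
  have h4 : star a * a - star a * a * e = (c - c * e) + ((y - y * e : I) : A) := by
    change _ = (c - c * e) + ((star a * a - c) - (star a * a - c) * e)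
    noncomm_ring
  calc ‖I.proj a‖ * ‖I.proj a‖ ≤ ‖a - a * e‖ * ‖a - a * e‖ := by gcongr
    _ = ‖star (a - a * (e : A)) * (a - a * e)‖ := (CStarRing.norm_star_mul_self).symm
    _ ≤ ‖star a * a - star a * a * e‖ := by rw [h2]; exact h3
    _ ≤ ‖c - c * (e : A)‖ + ‖((y - y * e : I) : A)‖ := by rw [h4]; exact norm_add_le _ _
    _ ≤ ‖c‖ + ‖y - y * e‖ := by
        gcongr
        · rw [hb']; exact norm_sub_mul_le c b hn'
        · exact le_rfl

noncomputable instance : NonUnitalCStarAlgebra I.Quotient where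
  norm_mul_self_le := I.quotient_norm_mul_self_le
  smul_assoc c x y := by
    obtain ⟨a, rfl⟩ := I.proj_surjective x
    obtain ⟨b, rfl⟩ := I.proj_surjective y
    exact congrArg I.proj (smul_mul_assoc c a b)
  smul_comm c x y := by
    obtain ⟨a, rfl⟩ := I.proj_surjective x
    obtain ⟨b, rfl⟩ := I.proj_surjective y
    exact congrArg I.proj (mul_smul_comm c a b).symm
  star_smul c x := by
    obtain ⟨a, rfl⟩ := I.proj_surjective x
    exact congrArg I.proj (star_smul c a)

end Quotient

/-! ### Lattice operations, modular and maximal ideals -/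

section Lattice

variable {A : Type u} [NonUnitalCStarAlgebra A]

/-- The whole algebra is an ideal. -/
instance : Top (ClosedIdeal A) where
  top :=
    { (⊤ : Submodule ℂ A) with
      mul_mem_left' := fun _ _ _ => trivial
      mul_mem_right' := fun _ _ _ => trivial
      isClosed' := isClosed_univ }

/-- The intersection of a family of ideals; the empty intersection is the whole algebra. -/
instance : InfSet (ClosedIdeal A) where
  sInf S :=
    { carrier := {a | ∀ I ∈ S, a ∈ I}
      add_mem' := fun ha hb I hI => add_mem (ha I hI) (hb I hI)
      zero_mem' := fun I _ => zero_mem I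
      smul_mem' := fun c _ ha I hI => SMulMemClass.smul_mem c (ha I hI)
      mul_mem_left' := fun a _ hx I hI => I.mul_mem_left a (hx I hI)
      mul_mem_right' := fun a _ hx I hI => I.mul_mem_right a (hx I hI)
      isClosed' := by
        have : {a : A | ∀ I ∈ S, a ∈ I} = ⋂ I ∈ S, (I : Set A) := by ext; simp
        rw [this]
        exact isClosed_biInter fun I _ => I.isClosed }

theorem mem_top (a : A) : a ∈ (⊤ : ClosedIdeal A) := trivial

theorem mem_sInf {S : Set (ClosedIdeal A)} {a : A} : a ∈ sInf S ↔ ∀ I ∈ S, a ∈ I := Iff.rfl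

/-- The ideal `Id_A(X)` of `A` generated by a subset `X`. -/
def generate (X : Set A) : ClosedIdeal A := sInf {I : ClosedIdeal A | X ⊆ I}

/-- An ideal `I` is modular if the quotient `A / I` has an identity element. -/
def IsModular (I : ClosedIdeal A) : Prop :=
  ∃ e : I.Quotient, ∀ x : I.Quotient, e * x = x ∧ x * e = x

/-- A maximal ideal: a proper ideal that is contained in no other proper ideal. -/
def IsMaximal (I : ClosedIdeal A) : Prop :=
  I ≠ ⊤ ∧ ∀ J : ClosedIdeal A, I ≤ J → J ≠ ⊤ → J = I

end Lattice

end ClosedIdeal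

/-! ### Primitive ideals and the Jacobson topology -/

section Primitive

variable {A : Type u} [NonUnitalCStarAlgebra A]

/-- A ⋆-representation on a Hilbert space is irreducible if it is nonzero and its only closed
invariant subspaces are `0` and the whole space. -/
def IsIrreducibleRep {H : Type u} [NormedAddCommGroup H] [InnerProductSpace ℂ H]
    [CompleteSpace H] (π : A →⋆ₙₐ[ℂ] (H →L[ℂ] H)) : Prop :=
  (∃ a, π a ≠ 0) ∧
    ∀ K : Submodule ℂ H, IsClosed (K : Set H) → (∀ a, ∀ ξ ∈ K, π a ξ ∈ K) → K = ⊥ ∨ K = ⊤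

/-- A primitive ideal is the kernel of an irreducible ⋆-representation. An irreducible
representation is cyclic, so Hilbert spaces in the universe of `A` suffice. -/
def ClosedIdeal.IsPrimitive (P : ClosedIdeal A) : Prop :=
  ∃ (H : Type u) (_ : NormedAddCommGroup H) (_ : InnerProductSpace ℂ H) (_ : CompleteSpace H)
    (π : A →⋆ₙₐ[ℂ] (H →L[ℂ] H)), IsIrreducibleRep π ∧ ∀ a, a ∈ P ↔ π a = 0

variable (A) in
/-- `Prim(A)`, the set of primitive ideals of `A`. -/
def PrimitiveSpectrum : Type u := {P : ClosedIdeal A // P.IsPrimitive}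

/-- The primitive ideals that contain a subset `X` of `A`. -/
def hull (X : Set A) : Set (PrimitiveSpectrum A) := {P | X ⊆ (P.1 : Set A)}

theorem ClosedIdeal.IsPrimitive.mem_or_mem {P : ClosedIdeal A} (hP : P.IsPrimitive) {x y : A}
    (h : ∀ a, x * a * y ∈ P) : x ∈ P ∨ y ∈ P := by
  obtain ⟨H, _, _, _, π, ⟨⟨a₀, ha₀⟩, hirr⟩, hker⟩ := hP
  by_contra! hxy
  obtain ⟨hx, hy⟩ := hxy
  rw [hker] at hx hy
  obtain ⟨ξ, hξ⟩ : ∃ ξ, π y ξ ≠ 0 := by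
    by_contra! h0
    exact hy (ContinuousLinearMap.ext h0)
  -- the subspace killed by `π x * π a` for all `a`
  let K : Submodule ℂ H := ⨅ a : A, LinearMap.ker (π x * π a : H →L[ℂ] H).toLinearMap
  have hK : ∀ η, η ∈ K ↔ ∀ a, π x (π a η) = 0 := fun η => by simp [K, Submodule.mem_iInf]
  have hKc : IsClosed (K : Set H) := by
    have : (K : Set H) = ⋂ a : A, {η | π x (π a η) = 0} := by ext η; simp [hK]
    rw [this]
    exact isClosed_iInter fun a => isClosed_eq (by fun_prop) continuous_const
  have hKi : ∀ a, ∀ η ∈ K, π a η ∈ K := by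
    intro a η hη
    rw [hK] at hη ⊢
    intro b
    have := hη (b * a)
    rwa [map_mul] at this
  have hKmem : π y ξ ∈ K := by
    rw [hK]
    intro a
    have := (hker _).mp (h a)
    rw [map_mul, map_mul] at this
    exact congrArg (fun T : H →L[ℂ] H => T ξ) this
  have hKtop : K = ⊤ := by
    refine (hirr K hKc hKi).resolve_left fun hbot => hξ ?_
    rwa [hbot, Submodule.mem_bot] at hKmem
  -- the closed span of `π(A) H` is everything
  let L : Submodule ℂ H :=
    (Submodule.span ℂ {η | ∃ a ζ, η = π a ζ}).topologicalClosure
  have hLx : L ≤ LinearMap.ker (π x).toLinearMap := by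
    refine Submodule.topologicalClosure_minimal _ (Submodule.span_le.mpr ?_)
      (ContinuousLinearMap.isClosed_ker (π x))
    rintro _ ⟨a, ζ, rfl⟩
    exact (hK ζ).mp (hKtop ▸ Submodule.mem_top) a
  have hsub : ∀ a ζ, π a ζ ∈ L := fun a ζ =>
    Submodule.le_topologicalClosure _ (Submodule.subset_span ⟨a, ζ, rfl⟩)
  rcases hirr L (Submodule.isClosed_topologicalClosure _) (fun a η _ => hsub a η) with hL | hL
  · apply ha₀
    ext ζ
    have := hsub a₀ ζ
    rwa [hL, Submodule.mem_bot] at this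
  · apply hx
    ext ζ
    exact hLx (hL ▸ Submodule.mem_top)

/-- The Jacobson (hull-kernel) topology: the closed sets are the hulls of subsets of `A`. -/
instance : TopologicalSpace (PrimitiveSpectrum A) :=
  TopologicalSpace.ofClosed {S | ∃ X : Set A, S = hull X}
    ⟨Set.univ, by
      symm
      rw [Set.eq_empty_iff_forall_notMem]
      rintro ⟨P, H, _, _, _, π, ⟨⟨a, ha⟩, _⟩, hker⟩ hP
      exact ha ((hker a).mp (hP (Set.mem_univ a)))⟩
    (by
      intro F hF
      refine ⟨{a | ∃ X : Set A, hull X ∈ F ∧ a ∈ X}, ?_⟩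
      ext P
      constructor
      · rintro hP a ⟨X, hX, ha⟩
        exact hP _ hX ha
      · intro hP S hS
        obtain ⟨X, rfl⟩ := hF hS
        exact fun a ha => hP ⟨X, hS, ha⟩)
    (by
      rintro _ ⟨X, rfl⟩ _ ⟨Y, rfl⟩
      refine ⟨{z | ∃ x ∈ X, ∃ a, ∃ y ∈ Y, z = x * a * y}, ?_⟩
      ext P
      constructor
      · rintro (hP | hP) _ ⟨x, hx, a, y, hy, rfl⟩
        · exact P.1.mul_mem_right _ (P.1.mul_mem_right _ (hP hx))
        · exact P.1.mul_mem_left _ (hP hy)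
      · intro hP
        by_contra hcon
        rw [Set.mem_union, not_or] at hcon
        obtain ⟨x, hx, hxP⟩ := Set.not_subset.mp hcon.1
        obtain ⟨y, hy, hyP⟩ := Set.not_subset.mp hcon.2
        exact (P.2.mem_or_mem fun a => hP ⟨x, hx, a, y, hy, rfl⟩).elim hxP hyP)

/-- The kernel of a set of primitive ideals: their intersection (the whole algebra for `∅`). -/
def kernel (S : Set (PrimitiveSpectrum A)) : ClosedIdeal A := sInf (Subtype.val '' S)

end Primitive

/-! ### The properties of C⋆-algebras in the theorem -/

section Properties

variable (A : Type u) [NonUnitalCStarAlgebra A]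

/-- The centre-quotient property: `Z(A/I) = (Z(A) + I)/I`, the image of `Z(A)` in `A/I`,
for every ideal `I`. -/
def HasCQ : Prop :=
  ∀ I : ClosedIdeal A, Set.center I.Quotient = I.proj '' Set.center A

/-- `Max(A)`, the set of modular maximal ideals. -/
def modularMaximalIdeals : Set (ClosedIdeal A) := {M | M.IsMaximal ∧ M.IsModular}

/-- Weak centrality of a possibly non-unital C⋆-algebra. -/
def IsWeaklyCentral : Prop :=
  (∀ M ∈ modularMaximalIdeals A, ¬ Set.center A ⊆ (M : Set A)) ∧
    ∀ M ∈ modularMaximalIdeals A, ∀ N ∈ modularMaximalIdeals A,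
      (M : Set A) ∩ Set.center A = (N : Set A) ∩ Set.center A → M = N

/-- A C⋆-algebra is quasi-central if no primitive ideal contains its centre. -/
def IsQuasiCentral : Prop :=
  ∀ P : ClosedIdeal A, P.IsPrimitive → ¬ Set.center A ⊆ (P : Set A)

/-- `S_A`, the set of non-modular primitive ideals. -/
def nonModularPrimitives : Set (PrimitiveSpectrum A) := {P | ¬ P.1.IsModular}

/-- `J_A`, the intersection of the non-modular primitive ideals. -/
def idealJ : ClosedIdeal A := kernel (nonModularPrimitives A)

/-- `K_A`, the ideal generated by the centre. -/
def idealK : ClosedIdeal A := ClosedIdeal.generate (Set.center A)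

end Properties

namespace ClosedIdeal

open Filter Topology

variable {A : Type u} [NonUnitalCStarAlgebra A]

/-! Weak centrality implies the CQ-property by Stone–Weierstrass. The image `D` of `Z(A)` in the
commutative C⋆-algebra `C = Z(A/I)` is closed, being the range of a ⋆-homomorphism, so it is enough
that `D` separates the characters of `C`, zero included. Every nonzero character of `C` is cut out
by a modular maximal ideal of `A/I` (`exists_modularMaximal_of_character`). Pulled back to `A`,
condition (a) says that no nonzero character vanishes on `D`, and (b) that two nonzero characters
agreeing on `D` coincide. Conversely, the CQ-property applied to `M` and to `M ∩ N` lifts identities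
modulo `M` to central elements, and these witness (a) and (b).

For a weakly central `A`, a primitive ideal contains `Z(A)` exactly when it is non-modular: Schur's
lemma gives one direction, and a modular maximal ideal above a modular primitive one gives the
other. Thus `S_A` is the hull of `Z(A)`, hence closed, and `J_A = K_A` because closed ideals are
intersections of primitive ideals. This last fact rests on pure states (Krein–Milman) and the GNS
construction. Quasi-centrality of `K_A` is automatic, and weak centrality passes to ideals through
the CQ-property.

The returns from (iv) and (v) use that modular maximal ideals of `A` not containing `J` restrict
injectively to modular maximal ideals of `J`, together with `Z(J) = Z(A) ∩ J`. -/

theorem proj_eq_zero {I : ClosedIdeal A} {a : A} : I.proj a = 0 ↔ a ∈ I := by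
  rw [← I.proj_zero, I.proj_eq_proj, sub_zero]

theorem continuous_proj (I : ClosedIdeal A) : Continuous I.proj :=
  I.toSubmodule.continuous_mkQ

theorem eq_top_iff_forall {I : ClosedIdeal A} : I = ⊤ ↔ ∀ a, a ∈ I :=
  ⟨fun h a => h ▸ mem_top a, fun h => SetLike.ext fun a => ⟨fun _ => mem_top a, fun _ => h a⟩⟩

/-! ### Constructions of closed ideals -/

/-- The closure of an algebraic two-sided ideal. -/
def ofClosure (L : Submodule ℂ A) (hl : ∀ (a : A) {x : A}, x ∈ L → a * x ∈ L)
    (hr : ∀ (a : A) {x : A}, x ∈ L → x * a ∈ L) : ClosedIdeal A where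
  toSubmodule := L.topologicalClosure
  mul_mem_left' a _ hx :=
    map_mem_closure (f := fun y => a * y) (by fun_prop) hx fun _ hy => hl a hy
  mul_mem_right' a _ hx :=
    map_mem_closure (f := fun y => y * a) (by fun_prop) hx fun _ hy => hr a hy
  isClosed' := L.isClosed_topologicalClosure

theorem mem_ofClosure {L : Submodule ℂ A} {hl : ∀ (a : A) {x : A}, x ∈ L → a * x ∈ L}
    {hr : ∀ (a : A) {x : A}, x ∈ L → x * a ∈ L} {a : A} :
    a ∈ ofClosure L hl hr ↔ a ∈ closure (L : Set A) := Iff.rfl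

theorem subset_ofClosure {L : Submodule ℂ A} {hl : ∀ (a : A) {x : A}, x ∈ L → a * x ∈ L}
    {hr : ∀ (a : A) {x : A}, x ∈ L → x * a ∈ L} {a : A} (ha : a ∈ L) : a ∈ ofClosure L hl hr :=
  subset_closure ha

/-- The zero ideal. -/
instance : Bot (ClosedIdeal A) where
  bot :=
    { (⊥ : Submodule ℂ A) with
      mul_mem_left' := by
        rintro a x rfl
        exact mul_zero a
      mul_mem_right' := by
        rintro a x rfl
        exact zero_mul a
      isClosed' := isClosed_singleton }

theorem mem_bot {a : A} : a ∈ (⊥ : ClosedIdeal A) ↔ a = 0 := Iff.rfl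

/-- The preimage in `A` of an ideal of `A / I`. -/
def comapProj (I : ClosedIdeal A) (K : ClosedIdeal I.Quotient) : ClosedIdeal A where
  carrier := {a | I.proj a ∈ K}
  add_mem' ha hb := add_mem (S := ClosedIdeal I.Quotient) ha hb
  zero_mem' := zero_mem K
  smul_mem' c _ ha := SMulMemClass.smul_mem (S := ClosedIdeal I.Quotient) c ha
  mul_mem_left' a _ hx := K.mul_mem_left (I.proj a) hx
  mul_mem_right' a _ hx := K.mul_mem_right (I.proj a) hx
  isClosed' := K.isClosed.preimage I.continuous_proj

theorem mem_comapProj {I : ClosedIdeal A} {K : ClosedIdeal I.Quotient} {a : A} :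
    a ∈ I.comapProj K ↔ I.proj a ∈ K := Iff.rfl

theorem le_comapProj (I : ClosedIdeal A) (K : ClosedIdeal I.Quotient) : I ≤ I.comapProj K := by
  intro a ha
  rw [mem_comapProj, proj_eq_zero.mpr ha]
  exact zero_mem K

/-- The image in `A / I` of an ideal of `A` that contains `I`. -/
noncomputable def mapProj (I K : ClosedIdeal A) (h : I ≤ K) : ClosedIdeal I.Quotient where
  toSubmodule := K.toSubmodule.map I.toSubmodule.mkQ
  mul_mem_left' x y hy := by
    obtain ⟨a, rfl⟩ := I.proj_surjective x
    obtain ⟨b, hb, rfl⟩ := hy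
    exact ⟨a * b, K.mul_mem_left a hb, rfl⟩
  mul_mem_right' x y hy := by
    obtain ⟨a, rfl⟩ := I.proj_surjective x
    obtain ⟨b, hb, rfl⟩ := hy
    exact ⟨b * a, K.mul_mem_right a hb, rfl⟩
  isClosed' := by
    have hq : IsQuotientMap I.toSubmodule.mkQ := I.toSubmodule.isOpenQuotientMap_mkQ.isQuotientMap
    refine hq.isClosed_preimage.mp ?_
    convert K.isClosed using 1
    ext a
    constructor
    · rintro ⟨b, hb, hab⟩
      have h1 : a - b ∈ I := (I.proj_eq_proj).mp hab.symm
      have := add_mem (h h1) (show b ∈ K from hb)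
      rwa [sub_add_cancel] at this
    · exact fun ha => ⟨a, ha, rfl⟩

theorem proj_mem_mapProj {I K : ClosedIdeal A} (h : I ≤ K) {a : A} :
    I.proj a ∈ I.mapProj K h ↔ a ∈ K := by
  constructor
  · rintro ⟨b, hb, hab⟩
    have h1 : a - b ∈ I := (I.proj_eq_proj).mp hab.symm
    have := add_mem (h h1) (show b ∈ K from hb)
    rwa [sub_add_cancel] at this
  · exact fun ha => ⟨a, ha, rfl⟩

/-- The intersection `M ∩ J`, as an ideal of `J`. -/
def restrict (M J : ClosedIdeal A) : ClosedIdeal J where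
  carrier := {x | (x : A) ∈ M}
  add_mem' ha hb := add_mem (S := ClosedIdeal A) ha hb
  zero_mem' := zero_mem M
  smul_mem' c _ ha := SMulMemClass.smul_mem (S := ClosedIdeal A) c ha
  mul_mem_left' a _ hx := M.mul_mem_left (a : A) hx
  mul_mem_right' a _ hx := M.mul_mem_right (a : A) hx
  isClosed' := M.isClosed.preimage continuous_subtype_val

theorem mem_restrict {M J : ClosedIdeal A} {x : J} : x ∈ M.restrict J ↔ (x : A) ∈ M := Iff.rfl

/-- An ideal of an ideal `J` of `A` is an ideal of `A`. -/
def extend {J : ClosedIdeal A} (K : ClosedIdeal J) : ClosedIdeal A where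
  carrier := Subtype.val '' (K : Set J)
  add_mem' := by
    rintro _ _ ⟨a, ha, rfl⟩ ⟨b, hb, rfl⟩
    exact ⟨a + b, add_mem ha hb, rfl⟩
  zero_mem' := ⟨0, zero_mem K, rfl⟩
  smul_mem' := by
    rintro c _ ⟨a, ha, rfl⟩
    exact ⟨c • a, SMulMemClass.smul_mem c ha, rfl⟩
  mul_mem_left' := by
    rintro a _ ⟨x, hx, rfl⟩
    refine ⟨⟨a * x, J.mul_mem_left a x.2⟩, ?_, rfl⟩
    -- `K` absorbs only multiplication by `J`, so `a * x` is reached as the limit of `(a * e) * x`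
    -- with `a * e ∈ J`.
    obtain ⟨l, hl, -, hr, -⟩ := exists_approximateUnit J
    have h1 : Tendsto (fun e : J => (⟨a * e, J.mul_mem_left a e.2⟩ : J) * x) l
        (𝓝 ⟨a * x, J.mul_mem_left a x.2⟩) := by
      rw [tendsto_subtype_rng]
      have := ((continuous_subtype_val.tendsto _).comp (hr x)).const_mul a
      simpa [Function.comp_def, mul_assoc] using this
    exact K.isClosed.mem_of_tendsto h1 (Eventually.of_forall fun e => K.mul_mem_left _ hx)
  mul_mem_right' := by
    rintro a _ ⟨x, hx, rfl⟩
    refine ⟨⟨x * a, J.mul_mem_right a x.2⟩, ?_, rfl⟩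
    obtain ⟨l, hl, hr, -, -⟩ := exists_approximateUnit J
    have h1 : Tendsto (fun e : J => x * (⟨e * a, J.mul_mem_right a e.2⟩ : J)) l
        (𝓝 ⟨x * a, J.mul_mem_right a x.2⟩) := by
      rw [tendsto_subtype_rng]
      have := ((continuous_subtype_val.tendsto _).comp (hr x)).mul_const a
      simpa [Function.comp_def, mul_assoc] using this
    exact K.isClosed.mem_of_tendsto h1 (Eventually.of_forall fun e => K.mul_mem_right _ hx)
  isClosed' := J.isClosed.isClosedEmbedding_subtypeVal.isClosedMap _ K.isClosed

theorem coe_mem_extend {J : ClosedIdeal A} {K : ClosedIdeal J} {x : J} :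
    (x : A) ∈ extend K ↔ x ∈ K := by
  constructor
  · rintro ⟨y, hy, h⟩
    rwa [Subtype.ext h] at hy
  · exact fun h => ⟨x, h, rfl⟩

theorem extend_le {J : ClosedIdeal A} (K : ClosedIdeal J) : extend K ≤ J := by
  rintro _ ⟨x, -, rfl⟩
  exact x.2

/-! ### Modular ideals -/

/-- `e` is an identity modulo `I`. -/
def IsUnitMod (I : ClosedIdeal A) (e : A) : Prop := ∀ x, e * x - x ∈ I ∧ x * e - x ∈ I

theorem isModular_iff {I : ClosedIdeal A} : I.IsModular ↔ ∃ e, I.IsUnitMod e := by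
  constructor
  · rintro ⟨e, he⟩
    obtain ⟨e, rfl⟩ := I.proj_surjective e
    exact ⟨e, fun x => ⟨(I.proj_eq_proj).mp (he (I.proj x)).1,
      (I.proj_eq_proj).mp (he (I.proj x)).2⟩⟩
  · rintro ⟨e, he⟩
    refine ⟨I.proj e, fun x => ?_⟩
    obtain ⟨x, rfl⟩ := I.proj_surjective x
    exact ⟨(I.proj_eq_proj).mpr (he x).1, (I.proj_eq_proj).mpr (he x).2⟩

theorem IsUnitMod.mono {I K : ClosedIdeal A} (h : I ≤ K) {e : A} (he : I.IsUnitMod e) :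
    K.IsUnitMod e := fun x => ⟨h (he x).1, h (he x).2⟩

theorem IsUnitMod.eq_top {I : ClosedIdeal A} {e : A} (he : I.IsUnitMod e) (h : e ∈ I) :
    I = ⊤ :=
  eq_top_iff_forall.mpr fun x => by
    have := sub_mem (I.mul_mem_right x h) (he x).1
    rwa [sub_sub_cancel] at this

/-- An element congruent to an identity modulo `I` is an identity modulo `I`. -/
theorem IsUnitMod.congr {I : ClosedIdeal A} {e f : A} (he : I.IsUnitMod e) (h : e - f ∈ I) :
    I.IsUnitMod f := fun x => by
  constructor
  · have := sub_mem (he x).1 (I.mul_mem_right x h)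
    convert this using 1; noncomm_ring
  · have := sub_mem (he x).2 (I.mul_mem_left x h)
    convert this using 1; noncomm_ring

/-- In the unitization `1 - d` is invertible with inverse `1 + s`. -/
theorem exists_eq_add_mul_of_norm_lt_one {d : A} (hd : ‖d‖ < 1) : ∃ s : A, s = d + d * s := by
  let d' : Unitization ℂ A := d
  have hd' : ‖d'‖ < 1 := by rwa [Unitization.norm_inr]
  let v : Unitization ℂ A := ((Units.oneSub d' hd')⁻¹ : (Unitization ℂ A)ˣ)
  have hv : (1 - d') * v = 1 := by
    have := (Units.oneSub d' hd').mul_inv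
    rwa [Units.val_oneSub] at this
  have hv' : v = 1 + d' * v := by
    rw [sub_mul, one_mul, sub_eq_iff_eq_add] at hv
    exact hv
  have h1 : v.fst = 1 := by
    rw [hv']
    simp [d']
  refine ⟨v.snd, ?_⟩
  have h2 := congrArg (fun w : Unitization ℂ A => w.snd) hv'
  simpa [h1, d'] using h2

/-- An algebraic ideal containing a modular ideal with identity `e` contains `e` as soon as its
closure does. -/
theorem IsUnitMod.mem_of_mem_closure {I : ClosedIdeal A} {e : A} (he : I.IsUnitMod e)
    {L : Submodule ℂ A} (hr : ∀ (a : A) {x : A}, x ∈ L → x * a ∈ L)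
    (hIL : ∀ x ∈ I, x ∈ L) (h : e ∈ closure (L : Set A)) : e ∈ L := by
  obtain ⟨y, hy, hd⟩ := Metric.mem_closure_iff.mp h 1 one_pos
  rw [dist_eq_norm] at hd
  obtain ⟨s, hs⟩ := exists_eq_add_mul_of_norm_lt_one hd
  -- Here `d = e - y`, and `s = d + d * s` is solved for `e`. The first term is a multiple of `y ∈
  -- L`; the other two lie in `I`, as `e` is an identity modulo `I`.
  have h1 : e = y * (e + s) - (y * e - y) - (e * s - s) := by
    have h2 : y * s = e - y + e * s - s := by
      rw [sub_mul] at hs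
      nth_rewrite 3 [hs]
      abel
    rw [mul_add, h2]
    abel
  rw [h1]
  exact sub_mem (sub_mem (hr _ hy) (hIL _ (he y).2)) (hIL _ (he s).1)

theorem IsMaximal.le_or_eq_top {M : ClosedIdeal A} (hM : M.IsMaximal) {K : ClosedIdeal A}
    (h : M ≤ K) : K ≤ M ∨ K = ⊤ := by
  by_cases hK : K = ⊤
  · exact Or.inr hK
  · exact Or.inl (hM.2 K h hK).le

theorem IsMaximal.eq_of_le {M N : ClosedIdeal A} (hM : M.IsMaximal) (hN : N.IsMaximal)
    (h : M ≤ N) : M = N := (hM.2 N h hN.1).symm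

theorem IsMaximal.unitMod_notMem {M : ClosedIdeal A} (hM : M.IsMaximal) {e : A}
    (he : M.IsUnitMod e) : e ∉ M := fun h => hM.1 (he.eq_top h)

/-- An ideal not contained in a modular maximal ideal `M` contains an identity modulo `M`. -/
theorem IsMaximal.exists_unitMod {M : ClosedIdeal A} (hM : M.IsMaximal) (hmod : M.IsModular)
    {J : ClosedIdeal A} (hJ : ¬ J ≤ M) : ∃ j ∈ J, M.IsUnitMod j := by
  obtain ⟨e, he⟩ := isModular_iff.mp hmod
  let L : Submodule ℂ A := J.toSubmodule ⊔ M.toSubmodule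
  have hL : ∀ x, x ∈ L ↔ ∃ j ∈ J, ∃ m ∈ M, j + m = x := fun x => Submodule.mem_sup
  have hl : ∀ (a : A) {x : A}, x ∈ L → a * x ∈ L := by
    intro a x hx
    obtain ⟨j, hj, m, hm, rfl⟩ := (hL x).mp hx
    exact (hL _).mpr ⟨a * j, J.mul_mem_left a hj, a * m, M.mul_mem_left a hm, (mul_add ..).symm⟩
  have hr : ∀ (a : A) {x : A}, x ∈ L → x * a ∈ L := by
    intro a x hx
    obtain ⟨j, hj, m, hm, rfl⟩ := (hL x).mp hx
    exact (hL _).mpr ⟨j * a, J.mul_mem_right a hj, m * a, M.mul_mem_right a hm, (add_mul ..).symm⟩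
  have hML : ∀ x ∈ M, x ∈ L := fun x hx => (hL x).mpr ⟨0, zero_mem J, x, hx, zero_add x⟩
  have hJL : ∀ x ∈ J, x ∈ L := fun x hx => (hL x).mpr ⟨x, hx, 0, zero_mem M, add_zero x⟩
  -- Maximality applies to the closure of `J + M`; `IsUnitMod.mem_of_mem_closure` then puts `e` in
  -- the sum itself.
  have htop : ofClosure L hl hr = ⊤ := by
    refine (hM.le_or_eq_top fun x hx => subset_ofClosure (hML x hx)).resolve_left fun h => ?_
    exact hJ fun x hx => h (subset_ofClosure (hJL x hx))
  have heL : e ∈ L := he.mem_of_mem_closure hr hML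
    (mem_ofClosure.mp (eq_top_iff_forall.mp htop e))
  obtain ⟨j, hj, m, hm, rfl⟩ := (hL e).mp heL
  exact ⟨j, hj, he.congr (by simpa using hm)⟩

/-- A proper modular ideal is contained in a modular maximal ideal. -/
theorem IsUnitMod.exists_le_maximal {I : ClosedIdeal A} {e : A} (he : I.IsUnitMod e)
    (hI : I ≠ ⊤) : ∃ M ∈ modularMaximalIdeals A, I ≤ M := by
  -- Above `I`, being proper means missing `e`, and this survives the closure of the union of a
  -- chain by `IsUnitMod.mem_of_mem_closure`.
  obtain ⟨M, hIM, hM⟩ := zorn_le_nonempty₀ {K : ClosedIdeal A | I ≤ K ∧ e ∉ K} (by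
    intro c hc hchain y hy
    have hdir : DirectedOn (· ≤ ·) (toSubmodule '' c) := by
      rintro _ ⟨K, hK, rfl⟩ _ ⟨K', hK', rfl⟩
      rcases hchain.total hK hK' with h | h
      · exact ⟨K'.toSubmodule, ⟨K', hK', rfl⟩, h, le_rfl⟩
      · exact ⟨K.toSubmodule, ⟨K, hK, rfl⟩, le_rfl, h⟩
    let L : Submodule ℂ A := sSup (toSubmodule '' c)
    have hL : ∀ x, x ∈ L ↔ ∃ K ∈ c, x ∈ K := by
      intro x
      refine (Submodule.mem_sSup_of_directed ⟨_, Set.mem_image_of_mem _ hy⟩ hdir).trans ?_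
      simp [mem_toSubmodule]
    have hl : ∀ (a : A) {x : A}, x ∈ L → a * x ∈ L := by
      intro a x hx
      obtain ⟨K, hK, hx⟩ := (hL x).mp hx
      exact (hL _).mpr ⟨K, hK, K.mul_mem_left a hx⟩
    have hr : ∀ (a : A) {x : A}, x ∈ L → x * a ∈ L := by
      intro a x hx
      obtain ⟨K, hK, hx⟩ := (hL x).mp hx
      exact (hL _).mpr ⟨K, hK, K.mul_mem_right a hx⟩
    have hIL : ∀ x ∈ I, x ∈ L := fun x hx => (hL x).mpr ⟨y, hy, (hc hy).1 hx⟩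
    refine ⟨ofClosure L hl hr, ⟨fun x hx => subset_ofClosure (hIL x hx), fun h => ?_⟩,
      fun K hK x hx => subset_ofClosure ((hL x).mpr ⟨K, hK, hx⟩)⟩
    obtain ⟨K, hK, heK⟩ := (hL e).mp (he.mem_of_mem_closure hr hIL h)
    exact (hc hK).2 heK) I ⟨le_rfl, fun h => hI (he.eq_top h)⟩
  refine ⟨M, ⟨⟨fun h => hM.prop.2 (h ▸ mem_top e), fun J hMJ hJ => ?_⟩,
    isModular_iff.mpr ⟨e, he.mono hIM⟩⟩, hIM⟩
  refine le_antisymm (hM.le_of_ge ⟨hIM.trans hMJ, fun h => hJ ?_⟩ hMJ) hMJ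
  exact (he.mono (hIM.trans hMJ)).eq_top h

/-- The preimage in `A` of a modular maximal ideal of `A / I`. -/
theorem comapProj_mem_modularMaximalIdeals {I : ClosedIdeal A} {M : ClosedIdeal I.Quotient}
    (hM : M ∈ modularMaximalIdeals I.Quotient) : I.comapProj M ∈ modularMaximalIdeals A := by
  obtain ⟨hmax, hmod⟩ := hM
  refine ⟨⟨fun h => hmax.1 ?_, fun K hK hKtop => ?_⟩, ?_⟩
  · refine eq_top_iff_forall.mpr fun x => ?_
    obtain ⟨a, rfl⟩ := I.proj_surjective x
    exact mem_comapProj.mp (eq_top_iff_forall.mp h a)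
  · have hIK := (I.le_comapProj M).trans hK
    have h1 : I.mapProj K hIK = M := by
      refine hmax.2 _ (fun x hx => ?_) fun h => hKtop ?_
      · obtain ⟨a, rfl⟩ := I.proj_surjective x
        exact (proj_mem_mapProj hIK).mpr (hK hx)
      · exact eq_top_iff_forall.mpr fun a =>
          (proj_mem_mapProj hIK).mp (eq_top_iff_forall.mp h _)
    exact SetLike.ext fun a => by rw [mem_comapProj, ← h1, proj_mem_mapProj]
  · obtain ⟨e, he⟩ := isModular_iff.mp hmod
    obtain ⟨e, rfl⟩ := I.proj_surjective e
    exact isModular_iff.mpr ⟨e, fun x => he (I.proj x)⟩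

/-- A modular maximal ideal of `A` not containing `J` restricts to one of `J`. -/
theorem restrict_mem_modularMaximalIdeals {M J : ClosedIdeal A}
    (hM : M ∈ modularMaximalIdeals A) (hJ : ¬ J ≤ M) :
    M.restrict J ∈ modularMaximalIdeals J := by
  obtain ⟨hmax, hmod⟩ := hM
  obtain ⟨j, hj, he⟩ := hmax.exists_unitMod hmod hJ
  have he' : (M.restrict J).IsUnitMod ⟨j, hj⟩ := fun x => he x
  refine ⟨⟨fun h => hmax.unitMod_notMem he ?_, fun K hK hKtop => ?_⟩,
    isModular_iff.mpr ⟨_, he'⟩⟩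
  · exact mem_restrict.mp (eq_top_iff_forall.mp h ⟨j, hj⟩)
  · refine le_antisymm (fun x hx => ?_) hK
    by_contra hxM
    obtain ⟨k, hk, hek⟩ := hmax.exists_unitMod hmod (J := extend K)
      fun h => hxM (h (coe_mem_extend.mpr hx))
    have hkJ : k ∈ J := extend_le K hk
    have hkK : (⟨k, hkJ⟩ : J) ∈ K := coe_mem_extend.mp hk
    exact hKtop (IsUnitMod.eq_top (fun x => ⟨hK (hek x).1, hK (hek x).2⟩) hkK)

/-- Modular maximal ideals not containing `J` are determined by their intersection with `J`. -/
theorem IsMaximal.eq_of_restrict_eq {M N J : ClosedIdeal A} (hM : M ∈ modularMaximalIdeals A)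
    (hN : N ∈ modularMaximalIdeals A) (hJ : ¬ J ≤ N)
    (h : M.restrict J = N.restrict J) : M = N := by
  by_contra hne
  have hMN : ¬ M ≤ N := fun h => hne (hM.1.eq_of_le hN.1 h)
  obtain ⟨m, hm, hem⟩ := hN.1.exists_unitMod hN.2 hMN
  obtain ⟨j, hj, hej⟩ := hN.1.exists_unitMod hN.2 hJ
  -- `m * j` lies in `M ∩ J`, hence in `N`, yet it is congruent to `j` modulo `N`; so the identity
  -- `j` would lie in `N`.
  have h1 : (⟨m * j, J.mul_mem_left m hj⟩ : J) ∈ M.restrict J := M.mul_mem_right j hm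
  rw [h, mem_restrict] at h1
  have h2 := sub_mem h1 (hem j).1
  rw [sub_sub_cancel] at h2
  exact hN.1.unitMod_notMem hej h2

/-! ### Centres -/

/-- An element of an ideal `J` commuting with `J` modulo an ideal `K` commutes with `A`
modulo `K`. -/
theorem commutator_mem_of_forall_mem {J K : ClosedIdeal A} {x : A} (hx : x ∈ J)
    (h : ∀ b ∈ J, x * b - b * x ∈ K) (a : A) : x * a - a * x ∈ K := by
  -- Derivation identity: `[x, a] j = [x, a j] - a [x, j]`. Taking `j = [x, a]⋆` below, the
  -- C⋆-identity in `A / K` finishes.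
  have h1 : ∀ j ∈ J, (x * a - a * x) * j ∈ K := by
    intro j hj
    have := sub_mem (h (a * j) (J.mul_mem_left a hj)) (K.mul_mem_left a (h j hj))
    convert this using 1; noncomm_ring
  have h2 : K.proj (x * a - a * x) = 0 := by
    have h3 := h1 _ (J.star_mem' (sub_mem (J.mul_mem_right a hx) (J.mul_mem_left a hx)))
    rw [← proj_eq_zero, proj_mul, proj_star, CStarRing.mul_star_self_eq_zero_iff] at h3
    exact h3
  exact proj_eq_zero.mp h2

theorem mem_center_iff_forall {B : Type*} [NonUnitalSemiring B] {z : B} :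
    z ∈ Set.center B ↔ ∀ b, z * b = b * z := by
  rw [Semigroup.mem_center_iff]
  exact forall_congr' fun b => eq_comm

/-- `Z(J) = Z(A) ∩ J`: this is `commutator_mem_of_forall_mem` with `K = ⊥`. -/
theorem mem_center_ideal_iff {J : ClosedIdeal A} {z : J} :
    z ∈ Set.center J ↔ (z : A) ∈ Set.center A := by
  rw [mem_center_iff_forall, mem_center_iff_forall]
  constructor
  · intro h a
    have := commutator_mem_of_forall_mem (K := ⊥) z.2 (fun b hb => mem_bot.mpr
      (sub_eq_zero.mpr (congrArg Subtype.val (h ⟨b, hb⟩)))) a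
    exact sub_eq_zero.mp (mem_bot.mp this)
  · exact fun h b => Subtype.ext (h b)

theorem proj_mem_center_iff {I : ClosedIdeal A} {x : A} :
    I.proj x ∈ Set.center I.Quotient ↔ ∀ b, x * b - b * x ∈ I := by
  rw [mem_center_iff_forall]
  constructor
  · exact fun h b => (I.proj_eq_proj).mp (h (I.proj b))
  · intro h y
    obtain ⟨b, rfl⟩ := I.proj_surjective y
    exact (I.proj_eq_proj).mpr (h b)

theorem proj_mem_center {I : ClosedIdeal A} {z : A} (hz : z ∈ Set.center A) :
    I.proj z ∈ Set.center I.Quotient :=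
  proj_mem_center_iff.mpr fun b => by
    rw [mem_center_iff_forall.mp hz b, sub_self]
    exact zero_mem I

/-- Elements that are central modulo `I` lift to central elements. -/
def LiftsCenter (I : ClosedIdeal A) : Prop :=
  ∀ x, (∀ b, x * b - b * x ∈ I) → ∃ z ∈ Set.center A, x - z ∈ I

theorem liftsCenter_iff {I : ClosedIdeal A} :
    I.LiftsCenter ↔ Set.center I.Quotient = I.proj '' Set.center A := by
  constructor
  · intro h
    refine Set.Subset.antisymm (fun y hy => ?_) ?_
    · obtain ⟨x, rfl⟩ := I.proj_surjective y
      obtain ⟨z, hz, hxz⟩ := h x (proj_mem_center_iff.mp hy)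
      exact ⟨z, hz, ((I.proj_eq_proj).mpr hxz).symm⟩
    · rintro _ ⟨z, hz, rfl⟩
      exact proj_mem_center hz
  · intro h x hx
    obtain ⟨z, hz, hzx⟩ := h.subset (proj_mem_center_iff.mpr hx)
    exact ⟨z, hz, (I.proj_eq_proj).mp hzx.symm⟩

end ClosedIdeal

theorem hasCQ_iff {A : Type u} [NonUnitalCStarAlgebra A] :
    HasCQ A ↔ ∀ I : ClosedIdeal A, I.LiftsCenter :=
  forall_congr' fun _ => ClosedIdeal.liftsCenter_iff.symm

open Filter Topology

/-! ### Closed ranges -/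

section ClosedRange

variable {A : Type u} [NonUnitalCStarAlgebra A]

namespace ClosedIdeal

/-- The canonical map `A → A / I` as a ⋆-homomorphism. -/
noncomputable def projHom (I : ClosedIdeal A) : A →⋆ₙₐ[ℂ] I.Quotient where
  toFun := I.proj
  map_smul' := I.proj_smul
  map_zero' := I.proj_zero
  map_add' := I.proj_add
  map_mul' := I.proj_mul
  map_star' := I.proj_star

open scoped CStarAlgebra in
/-- The kernel of a ⋆-homomorphism. -/
noncomputable def ker {B : Type*} [NonUnitalCStarAlgebra B] (f : A →⋆ₙₐ[ℂ] B) : ClosedIdeal A where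
  carrier := {a | f a = 0}
  add_mem' {a b} ha hb := by
    rw [Set.mem_ofPred_eq] at *
    rw [map_add, ha, hb, add_zero]
  zero_mem' := map_zero f
  smul_mem' c a ha := by
    rw [Set.mem_ofPred_eq] at *
    rw [map_smul, ha, smul_zero]
  mul_mem_left' a x hx := by
    rw [Set.mem_ofPred_eq] at *
    rw [map_mul, hx, mul_zero]
  mul_mem_right' a x hx := by
    rw [Set.mem_ofPred_eq] at *
    rw [map_mul, hx, zero_mul]
  isClosed' := isClosed_eq (map_continuous f) continuous_const

theorem mem_ker {B : Type*} [NonUnitalCStarAlgebra B] {f : A →⋆ₙₐ[ℂ] B} {a : A} :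
    a ∈ ker f ↔ f a = 0 := Iff.rfl

/-- The injective ⋆-homomorphism `A / ker f → B` induced by `f`. -/
noncomputable def kerLift {B : Type*} [NonUnitalCStarAlgebra B] (f : A →⋆ₙₐ[ℂ] B) :
    (ker f).Quotient →⋆ₙₐ[ℂ] B where
  toFun := _root_.Quotient.lift f fun a b h => by
    have h1 : a - b ∈ ker f := (ker f).toSubmodule.quotientRel_def.mp h
    rw [mem_ker, map_sub, sub_eq_zero] at h1
    exact h1
  map_smul' c x := by
    obtain ⟨a, rfl⟩ := (ker f).proj_surjective x
    exact map_smul f c a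
  map_zero' := map_zero f
  map_add' x y := by
    obtain ⟨a, rfl⟩ := (ker f).proj_surjective x
    obtain ⟨b, rfl⟩ := (ker f).proj_surjective y
    exact map_add f a b
  map_mul' x y := by
    obtain ⟨a, rfl⟩ := (ker f).proj_surjective x
    obtain ⟨b, rfl⟩ := (ker f).proj_surjective y
    exact map_mul f a b
  map_star' x := by
    obtain ⟨a, rfl⟩ := (ker f).proj_surjective x
    exact map_star f a

theorem kerLift_proj {B : Type*} [NonUnitalCStarAlgebra B] (f : A →⋆ₙₐ[ℂ] B) (a : A) :
    kerLift f ((ker f).proj a) = f a := rfl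

end ClosedIdeal

open ClosedIdeal in
/-- The range of a ⋆-homomorphism of C⋆-algebras is closed. -/
theorem NonUnitalStarAlgHom.isClosed_range_cstar {B : Type*} [NonUnitalCStarAlgebra B]
    (f : A →⋆ₙₐ[ℂ] B) : IsClosed (Set.range f) := by
  have hinj : Function.Injective (kerLift f) := by
    intro x y hxy
    obtain ⟨a, rfl⟩ := (ker f).proj_surjective x
    obtain ⟨b, rfl⟩ := (ker f).proj_surjective y
    rw [kerLift_proj, kerLift_proj] at hxy
    rw [proj_eq_proj, ClosedIdeal.mem_ker, map_sub, hxy, sub_self]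
  -- An injective ⋆-homomorphism of C⋆-algebras is isometric, so its range is complete.
  have h := (NonUnitalStarAlgHom.isometry (kerLift f) hinj).isClosedEmbedding.isClosed_range
  convert h using 1
  ext b
  constructor
  · rintro ⟨a, rfl⟩
    exact ⟨(ker f).proj a, rfl⟩
  · rintro ⟨x, rfl⟩
    obtain ⟨a, rfl⟩ := (ker f).proj_surjective x
    exact ⟨a, rfl⟩

end ClosedRange

/-! ### The centre as a commutative C⋆-algebra -/

section Center

variable (B : Type u) [NonUnitalCStarAlgebra B]

instance isClosed_nonUnitalStarSubalgebra_center :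
    IsClosed (NonUnitalStarSubalgebra.center ℂ B : Set B) := by
  have : (NonUnitalStarSubalgebra.center ℂ B : Set B) = ⋂ b : B, {z | z * b = b * z} := by
    ext z
    simp [ClosedIdeal.mem_center_iff_forall, NonUnitalStarSubalgebra.coe_center]
  rw [this]
  exact isClosed_iInter fun b => isClosed_eq (by fun_prop) (by fun_prop)

noncomputable instance : NonUnitalCommCStarAlgebra (NonUnitalStarSubalgebra.center ℂ B) where
  __ := NonUnitalStarSubalgebra.nonUnitalCStarAlgebra (NonUnitalStarSubalgebra.center ℂ B)
  mul_comm x y := Subtype.ext (ClosedIdeal.mem_center_iff_forall.mp x.2 y)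

end Center

/-! ### Stone–Weierstrass for commutative C⋆-algebras -/

open WeakDual in
/-- A ⋆-subalgebra of a commutative C⋆-algebra that separates the characters, zero included,
is dense. -/
theorem NonUnitalStarSubalgebra.mem_closure_of_separates {C : Type*} [NonUnitalCommCStarAlgebra C]
    (D : NonUnitalStarSubalgebra ℂ C)
    (hD : ∀ φ ψ : C →ₙₐ[ℂ] ℂ, (∀ d ∈ D, φ d = ψ d) → φ = ψ) (c : C) :
    c ∈ closure (D : Set C) := by
  let E : StarSubalgebra ℂ (Unitization ℂ C) :=
    { carrier := {x | x.snd ∈ D}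
      add_mem' := fun {x y} hx hy => by
        rw [Set.mem_ofPred_eq] at *
        rw [Unitization.snd_add]; exact add_mem hx hy
      mul_mem' := fun {x y} hx hy => by
        rw [Set.mem_ofPred_eq] at *
        rw [Unitization.snd_mul]
        exact add_mem (add_mem (SMulMemClass.smul_mem _ hy) (SMulMemClass.smul_mem _ hx))
          (mul_mem hx hy)
      algebraMap_mem' := fun r => zero_mem D
      star_mem' := fun {x} hx => by
        rw [Set.mem_ofPred_eq] at *
        rw [Unitization.snd_star]; exact star_mem hx }
  let G : Unitization ℂ C →⋆ₐ[ℂ] C(characterSpace ℂ (Unitization ℂ C), ℂ) :=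
    { gelfandTransform ℂ (Unitization ℂ C) with
      map_star' := fun x => gelfandTransform_map_star x }
  -- `E = ℂ + D`. A character of the unitization is determined by its restriction to `C`, and that
  -- restriction may be zero; this is why `hD` must also cover the zero map.
  have hsep : (E.map G).SeparatesPoints := by
    intro φ ψ hne
    by_contra! hcon
    apply hne
    have hφψ : ∀ x ∈ E, φ x = ψ x := fun x hx =>
      hcon (G x) ⟨G x, ⟨x, hx, rfl⟩, rfl⟩
    let r : characterSpace ℂ (Unitization ℂ C) → (C →ₙₐ[ℂ] ℂ) := fun χ =>
      (CharacterSpace.toAlgHom χ : Unitization ℂ C →ₙₐ[ℂ] ℂ).comp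
        (Unitization.inrNonUnitalAlgHom ℂ C)
    have h1 : r φ = r ψ := hD _ _ fun d hd => hφψ d hd
    ext x
    induction x using Unitization.ind with
    | inl_add_inr t y =>
      have h2 : φ (y : Unitization ℂ C) = ψ (y : Unitization ℂ C) := DFunLike.congr_fun h1 y
      have h3 : φ (Unitization.inl t) = ψ (Unitization.inl t) := hφψ _ (zero_mem D)
      rw [map_add, map_add, h2, h3]
  have hdense := ContinuousMap.starSubalgebra_topologicalClosure_eq_top_of_separatesPoints _ hsep
  have hiso : Isometry G := gelfandTransform_isometry (Unitization ℂ C)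
  have hcE : (c : Unitization ℂ C) ∈ closure (E : Set (Unitization ℂ C)) := by
    have h1 : G c ∈ closure (G '' (E : Set (Unitization ℂ C))) := by
      have : G c ∈ (E.map G).topologicalClosure := by
        rw [hdense]; trivial
      exact this
    rw [hiso.isEmbedding.closure_eq_preimage_closure_image]
    exact h1
  exact map_mem_closure Unitization.continuous_snd hcE fun x hx => hx

/-! ### Characters of the centre and modular maximal ideals -/

section Characters

variable {B : Type u} [NonUnitalCStarAlgebra B]

theorem NonUnitalAlgHom.continuous_of_cstar {C : Type*} [NonUnitalCStarAlgebra C]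
    (φ : C →ₙₐ[ℂ] ℂ) : Continuous φ := by
  have h : Continuous (Unitization.lift φ : Unitization ℂ C →ₐ[ℂ] ℂ) :=
    map_continuous (Unitization.lift φ : Unitization ℂ C →ₐ[ℂ] ℂ)
  have h2 := h.comp Unitization.continuous_inr
  convert h2 using 1
  ext x
  simp

/-- The kernel of a character is contained in a closed ideal `K` of the algebra that meets the
centre in that kernel. -/
theorem exists_closedIdeal_of_character
    (φ : NonUnitalStarSubalgebra.center ℂ B →ₙₐ[ℂ] ℂ) :
    ∃ K : ClosedIdeal B, ∀ c : NonUnitalStarSubalgebra.center ℂ B, (c : B) ∈ K ↔ φ c = 0 := by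
  let N : ClosedIdeal (NonUnitalStarSubalgebra.center ℂ B) :=
    { carrier := {c | φ c = 0}
      add_mem' := fun {a b} ha hb => by
        rw [Set.mem_ofPred_eq] at *
        rw [map_add, ha, hb, add_zero]
      zero_mem' := map_zero φ
      smul_mem' := fun c a ha => by
        rw [Set.mem_ofPred_eq] at *
        rw [map_smul, ha, smul_zero]
      mul_mem_left' := fun a x hx => by
        rw [Set.mem_ofPred_eq] at *
        rw [map_mul, hx, mul_zero]
      mul_mem_right' := fun a x hx => by
        rw [Set.mem_ofPred_eq] at *
        rw [map_mul, hx, zero_mul]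
      isClosed' := isClosed_eq φ.continuous_of_cstar continuous_const }
  -- `K` consists of the `b` on which an approximate unit of `N = ker φ` still acts as one. A
  -- central `c ∈ K` is a limit of the elements `e * c` of `N`, so `K` meets the centre only in `N`.
  obtain ⟨l, hl, -, hr, hev⟩ := ClosedIdeal.exists_approximateUnit N
  have hcomm : ∀ (e : N) (b : B), (e : B) * b = b * e := fun e =>
    ClosedIdeal.mem_center_iff_forall.mp e.1.2
  let K : ClosedIdeal B :=
    { carrier := {b | Tendsto (fun e : N => (e : B) * b) l (𝓝 b)}
      add_mem' := fun {a b} ha hb => by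
        rw [Set.mem_ofPred_eq] at *
        simpa only [mul_add] using ha.add hb
      zero_mem' := by
        rw [Set.mem_ofPred_eq]
        simpa only [mul_zero] using tendsto_const_nhds
      smul_mem' := fun c a ha => by
        rw [Set.mem_ofPred_eq] at *
        simpa only [mul_smul_comm] using ha.const_smul c
      mul_mem_left' := fun a x hx => by
        rw [Set.mem_ofPred_eq] at *
        have := hx.const_mul a
        refine this.congr fun e => ?_
        rw [← mul_assoc, ← hcomm, mul_assoc]
      mul_mem_right' := fun a x hx => by
        rw [Set.mem_ofPred_eq] at *
        have := hx.mul_const a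
        refine this.congr fun e => mul_assoc _ _ _
      isClosed' := by
        refine isClosed_of_closure_subset fun x hx => ?_
        rw [Set.mem_ofPred_eq, Metric.tendsto_nhds]
        intro ε hε
        obtain ⟨y, hy, hxy⟩ := Metric.mem_closure_iff.mp hx (ε / 3) (by positivity)
        rw [Set.mem_ofPred_eq, Metric.tendsto_nhds] at hy
        filter_upwards [hy (ε / 3) (by positivity), hev] with e he he'
        rw [dist_eq_norm] at *
        have he1 : ‖(e : B)‖ ≤ 1 := he'.2
        have h1 : (e : B) * x - x = e * (x - y) + (e * y - y) - (x - y) := by noncomm_ring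
        calc ‖(e : B) * x - x‖ ≤ ‖(e : B) * (x - y)‖ + ‖(e : B) * y - y‖ + ‖x - y‖ := by
              rw [h1]
              exact (norm_sub_le _ _).trans (by gcongr; exact norm_add_le _ _)
          _ ≤ 1 * ‖x - y‖ + ‖(e : B) * y - y‖ + ‖x - y‖ := by
              gcongr
              exact (norm_mul_le _ _).trans (by gcongr)
          _ < ε := by linarith }
  refine ⟨K, fun c => ⟨fun hc => ?_, fun hc => ?_⟩⟩
  · have h1 : Tendsto (fun e : N => (e : NonUnitalStarSubalgebra.center ℂ B) * c) l (𝓝 c) := by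
      rw [tendsto_subtype_rng]
      exact hc
    have h2 : c ∈ N := N.isClosed.mem_of_tendsto h1
      (Eventually.of_forall fun e => N.mul_mem_right c e.2)
    exact h2
  · have h1 := hr ⟨c, hc⟩
    have h2 : Continuous fun e : N => (e : B) := by fun_prop
    exact (h2.tendsto _).comp h1

/-- Every character of the centre is cut out by a modular maximal ideal. -/
theorem exists_modularMaximal_of_character
    (φ : NonUnitalStarSubalgebra.center ℂ B →ₙₐ[ℂ] ℂ) (hφ : φ ≠ 0) :
    ∃ M ∈ modularMaximalIdeals B,
      ∀ c : NonUnitalStarSubalgebra.center ℂ B, (c : B) ∈ M ↔ φ c = 0 := by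
  obtain ⟨K, hK⟩ := exists_closedIdeal_of_character φ
  obtain ⟨c₀, hc₀⟩ : ∃ c₀, φ c₀ = 1 := by
    obtain ⟨c, hc⟩ := DFunLike.ne_iff.mp hφ
    exact ⟨(φ c)⁻¹ • c, by rw [map_smul, smul_eq_mul, inv_mul_cancel₀ hc]⟩
  have hcomm := ClosedIdeal.mem_center_iff_forall.mp c₀.2
  -- `K` itself need not be modular. Passing to the elements that `c₀` multiplies into `K` makes
  -- `c₀` an identity, since `c₀ * c₀ - c₀ ∈ K`.
  let L : ClosedIdeal B :=
    { carrier := {b | (c₀ : B) * b ∈ K}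
      add_mem' := fun {a b} ha hb => by
        rw [Set.mem_ofPred_eq, mul_add]
        exact add_mem (S := ClosedIdeal B) ha hb
      zero_mem' := by
        rw [Set.mem_ofPred_eq, mul_zero]
        exact zero_mem K
      smul_mem' := fun c a ha => by
        rw [Set.mem_ofPred_eq, mul_smul_comm]
        exact SMulMemClass.smul_mem (S := ClosedIdeal B) c ha
      mul_mem_left' := fun a x hx => by
        rw [Set.mem_ofPred_eq, ← mul_assoc, hcomm, mul_assoc]
        exact K.mul_mem_left a hx
      mul_mem_right' := fun a x hx => by
        rw [Set.mem_ofPred_eq, ← mul_assoc]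
        exact K.mul_mem_right a hx
      isClosed' := K.isClosed.preimage (by fun_prop : Continuous fun b : B => (c₀ : B) * b) }
  have hc₀K : (c₀ * c₀ - c₀ : B) ∈ K := by
    have : (c₀ * c₀ + (-1 : ℂ) • c₀ : B) ∈ K := (hK (c₀ * c₀ + (-1 : ℂ) • c₀)).mpr
      (by rw [map_add, map_smul, map_mul, hc₀]; simp)
    rwa [neg_one_smul, ← sub_eq_add_neg] at this
  have hunit : L.IsUnitMod (c₀ : B) := by
    have hleft : ∀ x : B, (c₀ : B) * x - x ∈ L := fun x => by
      have h1 : (c₀ : B) * (c₀ * x - x) = (c₀ * c₀ - c₀) * x := by noncomm_ring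
      change (c₀ : B) * (c₀ * x - x) ∈ K
      rw [h1]
      exact K.mul_mem_right x hc₀K
    exact fun x => ⟨hleft x, hcomm x ▸ hleft x⟩
  have hne : L ≠ ⊤ := by
    intro h
    have h1 : (c₀ : B) * c₀ ∈ K := ClosedIdeal.eq_top_iff_forall.mp h c₀
    have h2 := (hK (c₀ * c₀)).mp h1
    rw [map_mul, hc₀] at h2
    simp at h2
  obtain ⟨M, hM, hLM⟩ := hunit.exists_le_maximal hne
  have hker : ∀ c : NonUnitalStarSubalgebra.center ℂ B, φ c = 0 → (c : B) ∈ M := fun c hc =>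
    hLM (K.mul_mem_left _ ((hK c).mpr hc))
  refine ⟨M, hM, fun c => ⟨fun hc => ?_, hker c⟩⟩
  -- `ker φ` has codimension one in the centre, so a central element of `M` outside it would force
  -- `c₀ ∈ M`.
  by_contra hne0
  have h1 : (c + (-φ c) • c₀ : B) ∈ M := hker (c + (-φ c) • c₀)
    (by rw [map_add, map_smul, hc₀]; simp)
  have h2 : (φ c • (c₀ : B)) ∈ M := by
    have := sub_mem hc h1
    simpa using this
  refine hM.1.unitMod_notMem (hunit.mono hLM) ?_
  have h3 : (φ c)⁻¹ • (φ c • (c₀ : B)) ∈ M := SMulMemClass.smul_mem _ h2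
  rwa [smul_smul, inv_mul_cancel₀ hne0, one_smul] at h3

end Characters

/-! ### The centre-quotient property and weak centrality -/

section WeaklyCentral

variable {A : Type u} [NonUnitalCStarAlgebra A]

open ClosedIdeal

/-- Characters with the same kernel coincide. -/
theorem NonUnitalAlgHom.eq_of_forall_eq_zero_iff {C : Type*} [NonUnitalCStarAlgebra C]
    {φ ψ : C →ₙₐ[ℂ] ℂ} (hφ : φ ≠ 0) (h : ∀ c, φ c = 0 → ψ c = 0) (h' : ∀ c, ψ c = 0 → φ c = 0) :
    φ = ψ := by
  obtain ⟨c, hc⟩ : ∃ c, φ c = 1 := by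
    obtain ⟨c, hc⟩ := DFunLike.ne_iff.mp hφ
    exact ⟨(φ c)⁻¹ • c, by rw [map_smul, smul_eq_mul, inv_mul_cancel₀ hc]⟩
  have h1 : ψ c = 1 := by
    have h2 := h (c * c - c) (by rw [map_sub, map_mul, hc]; simp)
    rw [map_sub, map_mul, sub_eq_zero] at h2
    have h3 : ψ c ≠ 0 := fun h4 => by simpa [hc] using h' c h4
    exact mul_left_cancel₀ h3 (by rw [h2, mul_one])
  ext x
  have h2 := h (x - φ x • c) (by rw [map_sub, map_smul, hc]; simp)
  rw [map_sub, map_smul, h1, sub_eq_zero] at h2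
  rw [h2]; simp

/-- Stone–Weierstrass makes the image `D` of `Z(A)` dense in `Z(A/I)`, and `D` is already closed as
the range of `f`. -/
theorem IsWeaklyCentral.hasCQ (h : IsWeaklyCentral A) : HasCQ A := by
  refine hasCQ_iff.mpr fun I x hx => ?_
  let C := NonUnitalStarSubalgebra.center ℂ I.Quotient
  let f : NonUnitalStarSubalgebra.center ℂ A →⋆ₙₐ[ℂ] I.Quotient :=
    I.projHom.comp (NonUnitalStarSubalgebraClass.subtype (NonUnitalStarSubalgebra.center ℂ A))
  have hf : ∀ z, f z = I.proj z := fun z => rfl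
  have hfc : ∀ z, f z ∈ C := fun z => proj_mem_center z.2
  let D : NonUnitalStarSubalgebra ℂ C :=
    { carrier := {c | ∃ z, f z = c}
      add_mem' := by
        rintro _ _ ⟨a, ha⟩ ⟨b, hb⟩
        exact ⟨a + b, by rw [map_add, ha, hb]; rfl⟩
      zero_mem' := ⟨0, by rw [map_zero]; rfl⟩
      mul_mem' := by
        rintro _ _ ⟨a, ha⟩ ⟨b, hb⟩
        exact ⟨a * b, by rw [map_mul, ha, hb]; rfl⟩
      smul_mem' := by
        rintro r _ ⟨a, ha⟩
        exact ⟨r • a, by rw [map_smul, ha]; rfl⟩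
      star_mem' := by
        rintro _ ⟨a, ha⟩
        exact ⟨star a, by rw [map_star, ha]; rfl⟩ }
  have hDf : ∀ z, (⟨f z, hfc z⟩ : C) ∈ D := fun z => ⟨z, rfl⟩
  have hsep : ∀ φ ψ : C →ₙₐ[ℂ] ℂ, (∀ d ∈ D, φ d = ψ d) → φ = ψ := by
    have hzero : ∀ φ : C →ₙₐ[ℂ] ℂ, (∀ d ∈ D, φ d = 0) → φ = 0 := by
      intro φ hφ
      by_contra hne
      obtain ⟨M, hM, hMφ⟩ := exists_modularMaximal_of_character φ hne
      refine h.1 _ (comapProj_mem_modularMaximalIdeals hM) fun z hz => ?_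
      exact (hMφ ⟨f ⟨z, hz⟩, hfc _⟩).mpr (hφ _ (hDf _))
    intro φ ψ hφψ
    by_cases hφ : φ = 0
    · rw [hφ]
      exact (hzero ψ fun d hd => by rw [← hφψ d hd, hφ]; rfl).symm
    by_cases hψ : ψ = 0
    · rw [hψ]
      exact hzero φ fun d hd => by rw [hφψ d hd, hψ]; rfl
    obtain ⟨M, hM, hMφ⟩ := exists_modularMaximal_of_character φ hφ
    obtain ⟨N, hN, hNψ⟩ := exists_modularMaximal_of_character ψ hψ
    -- `φ` and `ψ` agree on the image of `Z(A)`, so the two pullbacks meet `Z(A)` in the same set.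
    have hMN : I.comapProj M = I.comapProj N := by
      refine h.2 _ (comapProj_mem_modularMaximalIdeals hM) _
        (comapProj_mem_modularMaximalIdeals hN) ?_
      ext z
      refine and_congr_left fun hz => ?_
      have h1 := hMφ ⟨f ⟨z, hz⟩, hfc _⟩
      rw [hφψ _ (hDf _), ← hNψ] at h1
      exact h1
    have hMN' : ∀ y, y ∈ M ↔ y ∈ N := fun y => by
      obtain ⟨a, rfl⟩ := I.proj_surjective y
      rw [← mem_comapProj, hMN, mem_comapProj]
    refine NonUnitalAlgHom.eq_of_forall_eq_zero_iff hφ (fun c hc => ?_) fun c hc => ?_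
    · rwa [← hNψ, ← hMN', hMφ]
    · rwa [← hMφ, hMN', hNψ]
  have hmem := D.mem_closure_of_separates hsep ⟨I.proj x, proj_mem_center_iff.mpr hx⟩
  have hrange : I.proj x ∈ closure (Set.range f) :=
    map_mem_closure (f := (Subtype.val : C → I.Quotient)) continuous_subtype_val hmem
      fun c hc => hc
  rw [f.isClosed_range_cstar.closure_eq] at hrange
  obtain ⟨z, hz⟩ := hrange
  exact ⟨z, z.2, (I.proj_eq_proj).mp hz.symm⟩

/-- An identity modulo `M` is central modulo `M`; its central lift lies outside `M`. -/
theorem ClosedIdeal.LiftsCenter.not_center_subset {M : ClosedIdeal A}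
    (hM : M ∈ modularMaximalIdeals A) (h : M.LiftsCenter) : ¬ Set.center A ⊆ (M : Set A) := by
  intro hZ
  obtain ⟨e, he⟩ := isModular_iff.mp hM.2
  obtain ⟨z, hz, hez⟩ := h e fun b => by
    have := sub_mem (he b).1 (he b).2
    rwa [sub_sub_sub_cancel_right] at this
  refine hM.1.unitMod_notMem he ?_
  have := add_mem hez (hZ hz : z ∈ M)
  rwa [sub_add_cancel] at this

/-- If `M ≠ N`, some `j ∈ N` is an identity modulo `M`. It behaves like `(1, 0)` in `A/M × A/N`, so
it is central modulo `M ∩ N`, and its central lift lies in `N` but not in `M`. -/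
theorem ClosedIdeal.LiftsCenter.eq_of_inter_center_eq {M N : ClosedIdeal A}
    (hM : M ∈ modularMaximalIdeals A) (hN : N ∈ modularMaximalIdeals A)
    (h : (sInf {M, N}).LiftsCenter)
    (hMN : (M : Set A) ∩ Set.center A = (N : Set A) ∩ Set.center A) : M = N := by
  by_contra hne
  obtain ⟨j, hjN, hj⟩ := hM.1.exists_unitMod hM.2
    (fun hle : N ≤ M => hne (hN.1.eq_of_le hM.1 hle).symm)
  obtain ⟨z, hz, hjz⟩ := h j fun b => by
    rintro K (rfl | rfl)
    · have := sub_mem (hj b).1 (hj b).2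
      rwa [sub_sub_sub_cancel_right] at this
    · exact sub_mem (K.mul_mem_right b hjN) (K.mul_mem_left b hjN)
  have hzN : z ∈ N := by
    have := sub_mem hjN (hjz N (by simp))
    rwa [sub_sub_cancel] at this
  have hzM : z ∈ M := (hMN.superset ⟨hzN, hz⟩).1
  refine hM.1.unitMod_notMem hj ?_
  have := add_mem (hjz M (by simp)) hzM
  rwa [sub_add_cancel] at this

theorem HasCQ.isWeaklyCentral (h : HasCQ A) : IsWeaklyCentral A :=
  ⟨fun M hM => (hasCQ_iff.mp h M).not_center_subset hM,
    fun _ hM _ hN => (hasCQ_iff.mp h _).eq_of_inter_center_eq hM hN⟩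

theorem HasCQ.quotient (h : HasCQ A) (J : ClosedIdeal A) : HasCQ J.Quotient := by
  refine hasCQ_iff.mpr fun I x hx => ?_
  obtain ⟨x, rfl⟩ := J.proj_surjective x
  obtain ⟨z, hz, hxz⟩ := hasCQ_iff.mp h (J.comapProj I) x fun b => hx (J.proj b)
  exact ⟨J.proj z, proj_mem_center hz, hxz⟩

/-- An ideal `I` of `J` is an ideal of `A`, and a central lift of `x ∈ J` modulo `I` stays in `J`
because `I ⊆ J`. -/
theorem HasCQ.ideal (h : HasCQ A) (J : ClosedIdeal A) : HasCQ J := by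
  refine hasCQ_iff.mpr fun I x hx => ?_
  obtain ⟨z, hz, hxz⟩ := hasCQ_iff.mp h (extend I) x
    (commutator_mem_of_forall_mem x.2 fun b hb => coe_mem_extend.mpr (hx ⟨b, hb⟩))
  have hzJ : z ∈ J := by
    have := sub_mem x.2 (extend_le I hxz)
    rwa [sub_sub_cancel] at this
  exact ⟨⟨z, hzJ⟩, mem_center_ideal_iff.mpr hz, coe_mem_extend.mp hxz⟩

/-- Weak centrality of an ideal `J` controls the modular maximal ideals not containing `J`. -/
theorem IsWeaklyCentral.exists_center_notMem {J : ClosedIdeal A} (hJ : IsWeaklyCentral J)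
    {M : ClosedIdeal A} (hM : M ∈ modularMaximalIdeals A) (hJM : ¬ J ≤ M) :
    ∃ z ∈ Set.center A, z ∈ J ∧ z ∉ M := by
  have := hJ.1 _ (restrict_mem_modularMaximalIdeals hM hJM)
  obtain ⟨z, hz, hzM⟩ := Set.not_subset.mp this
  exact ⟨z, mem_center_ideal_iff.mp hz, z.2, hzM⟩

theorem IsWeaklyCentral.eq_of_inter_center_eq {J : ClosedIdeal A} (hJ : IsWeaklyCentral J)
    {M N : ClosedIdeal A} (hM : M ∈ modularMaximalIdeals A) (hN : N ∈ modularMaximalIdeals A)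
    (hJM : ¬ J ≤ M) (hJN : ¬ J ≤ N)
    (h : (M : Set A) ∩ Set.center A = (N : Set A) ∩ Set.center A) : M = N := by
  refine IsMaximal.eq_of_restrict_eq hM hN hJN ?_
  refine hJ.2 _ (restrict_mem_modularMaximalIdeals hM hJM) _
    (restrict_mem_modularMaximalIdeals hN hJN) ?_
  ext z
  refine and_congr_left fun hz => ?_
  have hz' := mem_center_ideal_iff.mp hz
  exact ⟨fun hzM => (h.subset ⟨hzM, hz'⟩).1, fun hzN => (h.superset ⟨hzN, hz'⟩).1⟩

/-- Weak centrality is an extension property for extensions that lift central elements. -/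
theorem isWeaklyCentral_of_extension (J : ClosedIdeal A) (hJ : HasCQ J) (hQ : HasCQ J.Quotient)
    (hZ : Set.center J.Quotient = J.proj '' Set.center A) : IsWeaklyCentral A := by
  -- Lifting is done in two stages: from `A/I` to `A/J` by `hQ`, then to `A` by `hZ`.
  have hlift : ∀ I : ClosedIdeal A, J ≤ I → I.LiftsCenter := by
    intro I hI x hx
    obtain ⟨y, hy, hxy⟩ := hasCQ_iff.mp hQ (J.mapProj I hI) (J.proj x) fun b => by
      obtain ⟨b, rfl⟩ := J.proj_surjective b
      exact (proj_mem_mapProj hI).mpr (hx b)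
    rw [hZ] at hy
    obtain ⟨z, hz, rfl⟩ := hy
    exact ⟨z, hz, (proj_mem_mapProj hI).mp hxy⟩
  have hJ' := hJ.isWeaklyCentral
  -- `Z(A) ∩ J` lies in `N` but not in `M`, so only pairs on the same side of `J` have to be
  -- compared.
  have hmixed : ∀ M ∈ modularMaximalIdeals A, ∀ N : ClosedIdeal A, ¬ J ≤ M → J ≤ N →
      (M : Set A) ∩ Set.center A ≠ (N : Set A) ∩ Set.center A := by
    intro M hM N hJM hJN h
    obtain ⟨z, hz, hzJ, hzM⟩ := hJ'.exists_center_notMem hM hJM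
    exact hzM (h.superset ⟨hJN hzJ, hz⟩).1
  refine ⟨fun M hM => ?_, fun M hM N hN h => ?_⟩
  · by_cases hJM : J ≤ M
    · exact (hlift M hJM).not_center_subset hM
    · obtain ⟨z, hz, -, hzM⟩ := hJ'.exists_center_notMem hM hJM
      exact fun hsub => hzM (hsub hz)
  · by_cases hJM : J ≤ M
    · by_cases hJN : J ≤ N
      · refine (hlift _ ?_).eq_of_inter_center_eq hM hN h
        rintro x hx K (rfl | rfl)
        exacts [hJM hx, hJN hx]
      · exact absurd h.symm (hmixed N hN M hJN hJM)
    · by_cases hJN : J ≤ N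
      · exact absurd h (hmixed M hM N hJM hJN)
      · exact hJ'.eq_of_inter_center_eq hM hN hJM hJN h

end WeaklyCentral

/-! ### States -/

section States

variable {B : Type u} [CStarAlgebra B]

/-- A state of a unital C⋆-algebra: a contractive functional with value one at the identity. -/
def IsCStarState (f : StrongDual ℂ B) : Prop := f 1 = 1 ∧ ∀ x, ‖f x‖ ≤ ‖x‖

open scoped ComplexOrder in
-- Contractivity on `x + it` bounds `2 t Im f(x)` by `‖x‖²` for every real `t`, so `f(x)` is real.
-- Contractivity on `‖x‖ - x`, whose norm is at most `‖x‖`, gives the sign.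
theorem IsCStarState.nonneg [PartialOrder B] [StarOrderedRing B] {f : StrongDual ℂ B}
    (hf : IsCStarState f) {x : B} (hx : 0 ≤ x) : 0 ≤ f x := by
  rcases subsingleton_or_nontrivial B with _ | _
  · rw [Subsingleton.elim x 0, map_zero]
  have hsa : star x = x := (IsSelfAdjoint.of_nonneg hx).star_eq
  have him : (f x).im = 0 := by
    have key : ∀ t : ℝ, 2 * (f x).im * t ≤ ‖x‖ ^ 2 := by
      intro t
      have h1 : ‖x + (Complex.I * t) • (1 : B)‖ ^ 2 ≤ ‖x‖ ^ 2 + t ^ 2 := by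
        rw [sq, ← CStarRing.norm_star_mul_self]
        have h2 : star (x + (Complex.I * t) • (1 : B)) * (x + (Complex.I * t) • (1 : B))
            = x * x + ((t ^ 2 : ℝ) : ℂ) • (1 : B) := by
          have h3 : (-(Complex.I * t)) * (Complex.I * t) = ((t ^ 2 : ℝ) : ℂ) := by
            push_cast
            linear_combination (-(t : ℂ) ^ 2) * Complex.I_sq
          rw [star_add, hsa, star_smul, star_one]
          simp only [star_mul', Complex.star_def, Complex.conj_I, Complex.conj_ofReal,
            add_mul, mul_add, smul_mul_assoc, one_mul, mul_smul_comm, mul_one]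
          rw [← h3]
          module
        rw [h2]
        calc _ ≤ ‖x * x‖ + ‖((t ^ 2 : ℝ) : ℂ) • (1 : B)‖ := norm_add_le _ _
          _ ≤ ‖x‖ ^ 2 + t ^ 2 := by
            gcongr
            · rw [sq]; exact norm_mul_le _ _
            · rw [norm_smul, CStarRing.norm_one, mul_one, Complex.norm_real, Real.norm_eq_abs,
                abs_of_nonneg (sq_nonneg t)]
      have h4 : ‖f (x + (Complex.I * t) • (1 : B))‖ ^ 2 ≤ ‖x‖ ^ 2 + t ^ 2 :=
        le_trans (by gcongr; exact hf.2 _) h1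
      rw [map_add, map_smul, hf.1, ← Complex.normSq_eq_norm_sq, Complex.normSq_apply] at h4
      simp at h4
      nlinarith [sq_nonneg (f x).re, sq_nonneg (f x).im]
    by_contra hne
    have h1 := key ((‖x‖ ^ 2 + 1) / (2 * (f x).im))
    rw [mul_div_cancel₀ _ (by simpa using hne)] at h1
    linarith
  have hre : 0 ≤ (f x).re := by
    have h1 : x ≤ algebraMap ℝ B ‖x‖ := (IsSelfAdjoint.of_nonneg hx).le_algebraMap_norm_self
    have h2 : ‖algebraMap ℝ B ‖x‖ - x‖ ≤ ‖algebraMap ℝ B ‖x‖‖ :=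
      CStarAlgebra.norm_le_norm_of_nonneg_of_le (sub_nonneg.mpr h1) (sub_le_self _ hx)
    have h3 : ‖algebraMap ℝ B ‖x‖‖ = ‖x‖ := by
      rw [norm_algebraMap', norm_norm]
    have h4 : f (algebraMap ℝ B ‖x‖) = (‖x‖ : ℂ) := by
      rw [Algebra.algebraMap_eq_smul_one, ← Complex.coe_smul, map_smul, hf.1]
      simp
    have h5 := (hf.2 (algebraMap ℝ B ‖x‖ - x)).trans (h2.trans h3.le)
    rw [map_sub, h4] at h5
    have h6 := (Complex.re_le_norm _).trans h5
    simp at h6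
    linarith
  rw [Complex.le_def]
  exact ⟨by simpa using hre, by simpa using him.symm⟩

/-- There is a state attaining the norm at `star a * a`. -/
theorem exists_state_star_mul_self (a : B) [Nontrivial B] :
    ∃ f : StrongDual ℂ B, IsCStarState f ∧ f (star a * a) = (‖star a * a‖ : ℂ) := by
  let _ := CStarAlgebra.spectralOrder B
  have := CStarAlgebra.spectralOrderedRing B
  have hsa : IsSelfAdjoint (star a * a) := .star_mul_self a
  have : IsStarNormal (star a * a) := hsa.isStarNormal
  let C := StarAlgebra.elemental ℂ (star a * a)
  let h : C := ⟨star a * a, StarAlgebra.elemental.self_mem ℂ _⟩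
  have hh : IsSelfAdjoint h := Subtype.ext hsa.star_eq
  obtain ⟨k, hk, hkn⟩ := spectrum.exists_nnnorm_eq_spectralRadius h
  rw [hh.spectralRadius_eq_nnnorm] at hkn
  have hkn : ‖k‖ = ‖h‖ := by
    have : ‖k‖₊ = ‖h‖₊ := by exact_mod_cast hkn
    exact congrArg NNReal.toReal this
  obtain ⟨χ, hχ⟩ := WeakDual.CharacterSpace.mem_spectrum_iff_exists.mp hk
  let χ' : StrongDual ℂ C := WeakDual.toStrongDual (χ : WeakDual ℂ C)
  have hχ' : ∀ c, χ' c = χ c := fun c => rfl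
  -- The character `χ` takes at `star a * a` a spectral value `k` of modulus equal to the norm;
  -- Hahn–Banach extends it to `B`.
  obtain ⟨f, hf, hfn⟩ := exists_extension_norm_eq C.toSubalgebra.toSubmodule χ'
  have hnorm : ‖f‖ ≤ 1 := by
    rw [hfn]
    refine χ'.opNorm_le_bound zero_le_one fun c => ?_
    rw [hχ', one_mul]
    exact AlgHom.norm_apply_le_self (WeakDual.CharacterSpace.toAlgHom χ) c
  have hstate : IsCStarState f := by
    refine ⟨?_, fun x => ?_⟩
    · have h1 : f ((1 : C) : B) = χ 1 := hf (1 : C)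
      rw [map_one] at h1
      exact h1
    · exact (f.le_opNorm x).trans (mul_le_of_le_one_left (norm_nonneg x) hnorm)
  refine ⟨f, hstate, ?_⟩
  have h1 : f (star a * a) = k := (hf h).trans hχ
  have h2 := hstate.nonneg (star_mul_self_nonneg a)
  rw [Complex.eq_coe_norm_of_nonneg h2, h1, hkn]
  rfl

/-- There is an extreme point among the states attaining the norm at `star a * a`; it is
extreme among all states. -/
theorem exists_pure_state_star_mul_self (a : B) [Nontrivial B] :
    ∃ f : StrongDual ℂ B, IsCStarState f ∧ f (star a * a) = (‖star a * a‖ : ℂ) ∧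
      ∀ g h : StrongDual ℂ B, IsCStarState g → IsCStarState h → ∀ t : ℝ, 0 < t → t < 1 →
        f = t • g + (1 - t) • h → g = f := by
  let S : Set (WeakDual ℂ B) := WeakDual.toStrongDual ⁻¹' Metric.closedBall 0 1 ∩
    ({f | f 1 = 1} ∩ {f | f (star a * a) = (‖star a * a‖ : ℂ)})
  have hS : ∀ f : StrongDual ℂ B, StrongDual.toWeakDual f ∈ S ↔
      IsCStarState f ∧ f (star a * a) = (‖star a * a‖ : ℂ) := by
    intro f
    have h1 : StrongDual.toWeakDual f ∈
        WeakDual.toStrongDual ⁻¹' Metric.closedBall (0 : StrongDual ℂ B) 1 ↔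
          ∀ x, ‖f x‖ ≤ ‖x‖ := by
      have h2 : StrongDual.toWeakDual f ∈
          WeakDual.toStrongDual ⁻¹' Metric.closedBall (0 : StrongDual ℂ B) 1 ↔ ‖f‖ ≤ 1 := by
        rw [Set.mem_preimage, mem_closedBall_zero_iff]
        rfl
      rw [h2, ContinuousLinearMap.opNorm_le_iff zero_le_one]
      simp
    constructor
    · rintro ⟨h2, h3, h4⟩
      exact ⟨⟨h3, h1.mp h2⟩, h4⟩
    · rintro ⟨⟨h3, h2⟩, h4⟩
      exact ⟨h1.mpr h2, h3, h4⟩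
  have hcomp : IsCompact S := by
    refine (WeakDual.isCompact_closedBall 0 1).inter_right (IsClosed.inter ?_ ?_)
    · exact isClosed_eq (WeakDual.eval_continuous _) continuous_const
    · exact isClosed_eq (WeakDual.eval_continuous _) continuous_const
  have hne : S.Nonempty := by
    obtain ⟨f, hf, hfa⟩ := exists_state_star_mul_self a
    exact ⟨StrongDual.toWeakDual f, (hS f).mpr ⟨hf, hfa⟩⟩
  have : LocallyConvexSpace ℝ (WeakDual ℂ B) :=
    inferInstanceAs (LocallyConvexSpace ℝ (WeakBilin (topDualPairing ℂ B)))
  obtain ⟨F, hFS, hF⟩ := hcomp.extremePoints_nonempty hne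
  obtain ⟨f, rfl⟩ := StrongDual.toWeakDual.surjective F
  have hf := (hS f).mp hFS
  refine ⟨f, hf.1, hf.2, fun g h hg hh t ht0 ht1 hfgh => ?_⟩
  -- `S` is a face of the state space: if a proper convex combination of states attains the bound,
  -- each state does. Hence a Krein–Milman extreme point of `S` is extreme among all states.
  have hval : ∀ g h : StrongDual ℂ B, IsCStarState g → IsCStarState h → ∀ t : ℝ, 0 < t → t < 1 →
      f = t • g + (1 - t) • h → g (star a * a) = (‖star a * a‖ : ℂ) := by
    intro g h hg hh t ht0 ht1 hfgh
    have h1 := congrArg Complex.re hf.2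
    rw [hfgh] at h1
    simp only [add_apply, smul_apply, Complex.add_re,
      Complex.real_smul, Complex.re_ofReal_mul, Complex.ofReal_re] at h1
    have hg' := (Complex.re_le_norm _).trans (hg.2 (star a * a))
    have hh' := (Complex.re_le_norm _).trans (hh.2 (star a * a))
    have h2 : (g (star a * a)).re = ‖star a * a‖ := by nlinarith
    have h3 : (g (star a * a)).re = ‖g (star a * a)‖ :=
      le_antisymm (Complex.re_le_norm _) (h2 ▸ hg.2 _)
    rw [← h2]
    have h4 := (Complex.re_eq_norm.mp h3)
    exact Complex.eq_re_of_ofReal_le (r := 0) (by simpa using h4)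
  have hgS := (hS g).mpr ⟨hg, hval g h hg hh t ht0 ht1 hfgh⟩
  have hhS := (hS h).mpr ⟨hh, hval h g hh hg (1 - t) (by linarith) (by linarith) (by
    rw [hfgh, sub_sub_cancel, add_comm])⟩
  have := hF hgS hhS ⟨t, 1 - t, ht0, by linarith, by ring, by rw [hfgh]; rfl⟩
  exact StrongDual.toWeakDual.injective this

end States

/-! ### Irreducible representations -/

section Irreducible

variable {B : Type u} [CStarAlgebra B]

open scoped InnerProductSpace in
/-- A cyclic representation whose vector functional is extreme among the states is
irreducible. -/
theorem eq_bot_or_eq_top_of_pure {H : Type*} [NormedAddCommGroup H] [InnerProductSpace ℂ H]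
    [CompleteSpace H] (π : B →⋆ₐ[ℂ] (H →L[ℂ] H)) (ξ : H) (hξ : DenseRange fun b => π b ξ)
    (f : StrongDual ℂ B) (hf : IsCStarState f) (hfξ : ∀ b, f b = ⟪ξ, π b ξ⟫_ℂ)
    (hpure : ∀ g h : StrongDual ℂ B, IsCStarState g → IsCStarState h → ∀ t : ℝ, 0 < t → t < 1 →
      f = t • g + (1 - t) • h → g = f)
    (K : Submodule ℂ H) (hK : IsClosed (K : Set H)) (hinv : ∀ b, ∀ η ∈ K, π b η ∈ K) :
    K = ⊥ ∨ K = ⊤ := by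
  have : CompleteSpace K := hK.completeSpace_coe
  have hadj : ∀ (b : B) (x y : H), ⟪x, π b y⟫_ℂ = ⟪π (star b) x, y⟫_ℂ := by
    intro b x y
    rw [map_star, ContinuousLinearMap.star_eq_adjoint, ContinuousLinearMap.adjoint_inner_left]
  have hsum : ∀ x : H, (∀ b, ⟪x, π b ξ⟫_ℂ = 0) → x = 0 := by
    intro x hx
    have h1 : ∀ y, ⟪x, y⟫_ℂ = 0 := fun y =>
      hξ.induction_on (p := fun y => ⟪x, y⟫_ℂ = 0) y
        (isClosed_eq (by fun_prop) continuous_const) hx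
    exact inner_self_eq_zero.mp (h1 x)
  -- Splitting `ξ` along `K` and its orthogonal complement writes `f` as a convex combination of the
  -- vector states of `η` and `ζ`, with weights `‖η‖²` and `‖ζ‖²`.
  obtain ⟨η, hη, ζ, hζ, hξs⟩ := K.exists_add_mem_mem_orthogonal ξ
  have htop : ξ ∈ K → K = ⊤ := by
    intro h
    refine (Submodule.eq_top_iff').mpr fun y => ?_
    exact hξ.induction_on (p := fun y => y ∈ K) y hK fun b => hinv b ξ h
  have hKζ : ∀ k ∈ K, ⟪k, ζ⟫_ℂ = 0 := fun k hk => (Submodule.mem_orthogonal K ζ).mp hζ k hk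
  have hζK : ∀ k ∈ K, ⟪ζ, k⟫_ℂ = 0 := fun k hk => (Submodule.mem_orthogonal' K ζ).mp hζ k hk
  have hηζ : ∀ b, ⟪η, π b ζ⟫_ℂ = 0 := fun b => by rw [hadj]; exact hKζ _ (hinv _ η hη)
  have hζη : ∀ b, ⟪ζ, π b η⟫_ℂ = 0 := fun b => hζK _ (hinv _ η hη)
  have hηξ : ∀ b, ⟪η, π b ξ⟫_ℂ = ⟪η, π b η⟫_ℂ := fun b => by
    rw [hξs, map_add, inner_add_right, hηζ, add_zero]
  have hdecomp : ∀ b, f b = ⟪η, π b η⟫_ℂ + ⟪ζ, π b ζ⟫_ℂ := fun b => by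
    rw [hfξ, hξs, map_add, inner_add_left, inner_add_right, inner_add_right, hηζ, hζη]
    ring
  by_cases hη0 : η = 0
  · left
    refine (Submodule.eq_bot_iff K).mpr fun k hk => hsum k fun b => ?_
    rw [hadj, hξs, hη0, zero_add]
    exact hKζ _ (hinv _ k hk)
  by_cases hζ0 : ζ = 0
  · right
    refine htop ?_
    rw [hξs, hζ0, add_zero]
    exact hη
  right
  have hone : ‖η‖ ^ 2 + ‖ζ‖ ^ 2 = 1 := by
    have h1 := hdecomp 1
    rw [hf.1, map_one, one_apply_eq_self, one_apply_eq_self,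
      inner_self_eq_norm_sq_to_K, inner_self_eq_norm_sq_to_K] at h1
    have h2 := congrArg Complex.re h1
    simp only [Complex.one_re, Complex.add_re, ← Complex.ofReal_pow, Complex.coe_algebraMap,
      Complex.ofReal_re] at h2
    exact h2.symm
  have hηpos : 0 < ‖η‖ ^ 2 := by positivity
  have hζpos : 0 < ‖ζ‖ ^ 2 := by positivity
  -- the normalized vector functional of a nonzero vector
  have hvec : ∀ v : H, v ≠ 0 → ∃ g : StrongDual ℂ B, IsCStarState g ∧
      ∀ b, (‖v‖ ^ 2) • g b = ⟪v, π b v⟫_ℂ := by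
    intro v hv
    have hvpos : 0 < ‖v‖ ^ 2 := by positivity
    let g₀ : B →ₗ[ℂ] ℂ :=
      { toFun := fun b => (((‖v‖ ^ 2)⁻¹ : ℝ) : ℂ) * ⟪v, π b v⟫_ℂ
        map_add' := fun x y => by
          rw [map_add, add_apply, inner_add_right, mul_add]
        map_smul' := fun c x => by
          rw [map_smul, smul_apply, inner_smul_right, RingHom.id_apply,
            smul_eq_mul]
          ring }
    have hbound : ∀ b, ‖g₀ b‖ ≤ 1 * ‖b‖ := by
      intro b
      have h1 : ‖⟪v, π b v⟫_ℂ‖ ≤ ‖v‖ ^ 2 * ‖b‖ :=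
        calc ‖⟪v, π b v⟫_ℂ‖ ≤ ‖v‖ * ‖π b v‖ := norm_inner_le_norm _ _
          _ ≤ ‖v‖ * (‖π b‖ * ‖v‖) := by gcongr; exact (π b).le_opNorm v
          _ ≤ ‖v‖ * (‖b‖ * ‖v‖) := by gcongr; exact NonUnitalStarAlgHom.norm_apply_le π b
          _ = ‖v‖ ^ 2 * ‖b‖ := by ring
      change ‖(((‖v‖ ^ 2)⁻¹ : ℝ) : ℂ) * ⟪v, π b v⟫_ℂ‖ ≤ _
      rw [norm_mul, Complex.norm_real, Real.norm_of_nonneg (by positivity), inv_mul_le_iff₀ hvpos,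
        one_mul]
      exact h1
    have hg₀ : ∀ b, (‖v‖ ^ 2) • g₀ b = ⟪v, π b v⟫_ℂ := by
      intro b
      change (‖v‖ ^ 2) • ((((‖v‖ ^ 2)⁻¹ : ℝ) : ℂ) * ⟪v, π b v⟫_ℂ) = _
      rw [Complex.real_smul, ← mul_assoc, ← Complex.ofReal_mul, mul_inv_cancel₀ hvpos.ne',
        Complex.ofReal_one, one_mul]
    refine ⟨g₀.mkContinuous 1 hbound, ⟨?_, fun x => by simpa using hbound x⟩, hg₀⟩
    have h1 := hg₀ 1
    rw [map_one π, one_apply_eq_self, inner_self_eq_norm_sq_to_K, Complex.real_smul] at h1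
    have h2 : ((‖v‖ ^ 2 : ℝ) : ℂ) ≠ 0 := by exact_mod_cast hvpos.ne'
    refine mul_left_cancel₀ h2 ?_
    rw [mul_one]
    refine h1.trans ?_
    simp
  obtain ⟨g, hg, hgη⟩ := hvec η hη0
  obtain ⟨h, hh, hhζ⟩ := hvec ζ hζ0
  have hgf : g = f := by
    refine hpure g h hg hh (‖η‖ ^ 2) hηpos (by linarith) ?_
    ext b
    rw [show 1 - ‖η‖ ^ 2 = ‖ζ‖ ^ 2 by linarith]
    change f b = (‖η‖ ^ 2) • g b + (‖ζ‖ ^ 2) • h b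
    rw [hgη, hhζ, hdecomp]
  -- With `g = f`, both vectors have the same inner products with the dense set of `π b ξ`. Hence
  -- `ξ` is a multiple of `η` and lies in `K`.
  have hηeq : η - ((‖η‖ ^ 2 : ℝ) : ℂ) • ξ = 0 := by
    refine hsum _ fun b => ?_
    rw [inner_sub_left, inner_smul_left, hηξ, ← hgη, hgf, hfξ, Complex.conj_ofReal,
      Complex.real_smul, sub_self]
  refine htop ?_
  have hne : ((‖η‖ ^ 2 : ℝ) : ℂ) ≠ 0 := by exact_mod_cast hηpos.ne'
  have h1 : ξ = ((‖η‖ ^ 2 : ℝ) : ℂ)⁻¹ • η := by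
    rw [eq_inv_smul_iff₀ hne]
    exact (sub_eq_zero.mp hηeq).symm
  rw [h1]
  exact K.smul_mem _ hη

open scoped InnerProductSpace ComplexOrder in
/-- The irreducible representations of a unital C⋆-algebra separate points. -/
theorem exists_irreducible_unital (a : B) (ha : a ≠ 0) :
    ∃ (H : Type u) (_ : NormedAddCommGroup H) (_ : InnerProductSpace ℂ H) (_ : CompleteSpace H)
      (π : B →⋆ₐ[ℂ] (H →L[ℂ] H)), π a ≠ 0 ∧
      ∀ K : Submodule ℂ H, IsClosed (K : Set H) → (∀ b, ∀ ξ ∈ K, π b ξ ∈ K) →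
        K = ⊥ ∨ K = ⊤ := by
  let _ := CStarAlgebra.spectralOrder B
  have := CStarAlgebra.spectralOrderedRing B
  have : Nontrivial B := ⟨a, 0, ha⟩
  obtain ⟨f, hf, hfa, hpure⟩ := exists_pure_state_star_mul_self a
  let F : B →ₚ[ℂ] ℂ := PositiveLinearMap.mk₀ (f : B →ₗ[ℂ] ℂ) fun x hx => hf.nonneg hx
  have hF : ∀ b, F b = f b := fun b => rfl
  let ξ : F.GNS := (F.toPreGNS 1 : F.PreGNS)
  have hπξ : ∀ b, F.gnsStarAlgHom b ξ = (F.toPreGNS b : F.PreGNS) := by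
    intro b
    change F.gnsNonUnitalStarAlgHom b ξ = _
    rw [PositiveLinearMap.gnsNonUnitalStarAlgHom_apply_coe,
      PositiveLinearMap.leftMulMapPreGNS_apply]
    simp
  have hfξ : ∀ b, f b = ⟪ξ, F.gnsStarAlgHom b ξ⟫_ℂ := by
    intro b
    rw [hπξ, UniformSpace.Completion.inner_coe, PositiveLinearMap.preGNS_inner_def]
    simp [hF]
  refine ⟨F.GNS, inferInstance, inferInstance, inferInstance, F.gnsStarAlgHom, fun h0 => ?_,
    eq_bot_or_eq_top_of_pure F.gnsStarAlgHom ξ ?_ f hf hfξ hpure⟩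
  · have h1 := hfξ (star a * a)
    rw [map_mul F.gnsStarAlgHom, h0, mul_zero, zero_apply, inner_zero_right, hfa,
      CStarRing.norm_star_mul_self] at h1
    simp [ha] at h1
  · have h1 : (fun b => F.gnsStarAlgHom b ξ) = fun b => ((F.toPreGNS b : F.PreGNS) : F.GNS) :=
      funext hπξ
    rw [h1]
    exact UniformSpace.Completion.denseRange_coe.comp F.toPreGNS.surjective.denseRange
      (UniformSpace.Completion.continuous_coe _)

end Irreducible

/-! ### Primitive ideals -/

section PrimitiveIdeals

variable {A : Type u} [NonUnitalCStarAlgebra A]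

namespace ClosedIdeal

/-- A closed ideal is the intersection of the primitive ideals containing it. -/
theorem exists_primitive_of_notMem {I : ClosedIdeal A} {a : A} (ha : a ∉ I) :
    ∃ P : ClosedIdeal A, P.IsPrimitive ∧ I ≤ P ∧ a ∉ P := by
  have ha' : ((I.proj a : I.Quotient) : Unitization ℂ I.Quotient) ≠ 0 := by
    intro h
    refine ha (proj_eq_zero.mp (Unitization.inr_injective (R := ℂ) ?_))
    rw [h, Unitization.inr_zero]
  obtain ⟨H, _, _, _, π, hπ, hirr⟩ := exists_irreducible_unital _ ha'
  let ρ : A →⋆ₙₐ[ℂ] (H →L[ℂ] H) :=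
    (π : Unitization ℂ I.Quotient →⋆ₙₐ[ℂ] (H →L[ℂ] H)).comp
      ((Unitization.inrNonUnitalStarAlgHom ℂ I.Quotient).comp I.projHom)
  have hρ : ∀ x, ρ x = π (I.proj x : I.Quotient) := fun x => rfl
  refine ⟨ker ρ, ⟨H, _, _, _, ρ, ⟨⟨a, hπ⟩, fun K hK hinv => hirr K hK fun b ξ hξ => ?_⟩,
    fun _ => mem_ker⟩, fun x hx => ?_, hπ⟩
  -- Scalars preserve every subspace, so invariance under `A` already gives invariance under the
  -- unitization of `A / I`.
  · induction b using Unitization.ind with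
    | inl_add_inr t y =>
      obtain ⟨x, rfl⟩ := I.proj_surjective y
      have h1 : π (Unitization.inl t) = t • (1 : H →L[ℂ] H) := by
        rw [← map_one π, ← map_smul]
        congr 1
        ext <;> simp
      rw [map_add, h1, add_apply, smul_apply,
        one_apply_eq_self]
      exact K.add_mem (K.smul_mem t hξ) (hinv x ξ hξ)
  · rw [mem_ker, hρ, proj_eq_zero.mpr hx, Unitization.inr_zero, map_zero]

theorem IsPrimitive.ne_top {P : ClosedIdeal A} (hP : P.IsPrimitive) : P ≠ ⊤ := by
  obtain ⟨H, _, _, _, π, ⟨⟨a, ha⟩, -⟩, hker⟩ := hP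
  exact fun h => ha ((hker a).mp (eq_top_iff_forall.mp h a))

theorem IsMaximal.isPrimitive {M : ClosedIdeal A} (hM : M.IsMaximal) : M.IsPrimitive := by
  obtain ⟨a, ha⟩ : ∃ a, a ∉ M := by
    by_contra! h
    exact hM.1 (eq_top_iff_forall.mpr h)
  obtain ⟨P, hP, hMP, -⟩ := exists_primitive_of_notMem ha
  rwa [← hM.2 P hMP hP.ne_top]

end ClosedIdeal

end PrimitiveIdeals

/-! ### Schur's lemma -/

section Schur

variable {A : Type u} [NonUnitalCStarAlgebra A]

/-- A self-adjoint operator commuting with an irreducible representation is a scalar. -/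
theorem IsIrreducibleRep.exists_eq_algebraMap {H : Type u} [NormedAddCommGroup H]
    [InnerProductSpace ℂ H] [CompleteSpace H] {π : A →⋆ₙₐ[ℂ] (H →L[ℂ] H)}
    (hπ : IsIrreducibleRep π) {T : H →L[ℂ] H} (hT : IsSelfAdjoint T)
    (hcomm : ∀ a, Commute T (π a)) : ∃ r : ℝ, T = algebraMap ℝ (H →L[ℂ] H) r := by
  obtain ⟨⟨a₀, ha₀⟩, hirr⟩ := hπ
  have : Nontrivial (H →L[ℂ] H) := ⟨_, _, ha₀⟩
  -- The kernel of an operator commuting with `π` is invariant, so such an operator is zero or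
  -- injective.
  have hker : ∀ S : H →L[ℂ] H, (∀ a, Commute S (π a)) → S ≠ 0 → ∀ v, S v = 0 → v = 0 := by
    intro S hS hS0 v hv
    rcases hirr (LinearMap.ker S.toLinearMap) (ContinuousLinearMap.isClosed_ker S)
      (fun a ξ hξ => by
        have h1 : S (π a ξ) = π a (S ξ) := DFunLike.congr_fun (hS a).eq ξ
        have h2 : S ξ = 0 := hξ
        change S (π a ξ) = 0
        rw [h1, h2, map_zero]) with h | h
    · have h1 : v ∈ LinearMap.ker S.toLinearMap := hv
      rwa [h, Submodule.mem_bot] at h1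
    · refine absurd (ContinuousLinearMap.ext fun w => ?_) hS0
      have h1 : w ∈ LinearMap.ker S.toLinearMap := h ▸ Submodule.mem_top
      exact h1
  have hsub : ∀ x ∈ spectrum ℝ T, ∀ y ∈ spectrum ℝ T, ¬ x < y := by
    intro x hx y hy hxy
    -- Two spectral points would give nonzero functions of `T` supported on opposite sides of `m`,
    -- with product zero, contradicting `hker`.
    let m := (x + y) / 2
    let f : ℝ → ℝ := fun s => max (m - s) 0
    let g : ℝ → ℝ := fun s => max (s - m) 0
    have hf : Continuous f := by fun_prop
    have hg : Continuous g := by fun_prop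
    have hne : ∀ k : ℝ → ℝ, Continuous k → (∃ s ∈ spectrum ℝ T, k s ≠ 0) → cfc k T ≠ 0 := by
      rintro k hk ⟨s, hs, hks⟩ h0
      rw [← cfc_zero ℝ T] at h0
      exact hks (eqOn_of_cfc_eq_cfc (g := 0) h0 hk.continuousOn continuousOn_const hT hs)
    have hf0 : cfc f T ≠ 0 := hne f hf ⟨x, hx, (lt_max_of_lt_left
      (by simp only [m]; linarith)).ne'⟩
    have hg0 : cfc g T ≠ 0 := hne g hg ⟨y, hy, (lt_max_of_lt_left
      (by simp only [m]; linarith)).ne'⟩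
    have hfg : cfc f T * cfc g T = 0 := by
      rw [← cfc_mul f g T hf.continuousOn hg.continuousOn, ← cfc_zero ℝ T]
      congr 1
      ext s
      rcases le_total s m with h | h
      · simp [g, h]
      · simp [f, h]
    refine hg0 (ContinuousLinearMap.ext fun v => ?_)
    exact hker _ (fun a => (hcomm a).cfc_real f) hf0 _ (DFunLike.congr_fun hfg v)
  obtain ⟨r, hr⟩ := ContinuousFunctionalCalculus.spectrum_nonempty (R := ℝ) T hT
  refine ⟨r, ?_⟩
  rw [← cfc_const r T hT]
  nth_rewrite 1 [← cfc_id ℝ T hT]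
  exact cfc_congr fun s hs =>
    le_antisymm (not_lt.mp (hsub r hr s hs)) (not_lt.mp (hsub s hs r hr))

/-- A non-modular primitive ideal contains the centre. -/
theorem ClosedIdeal.IsPrimitive.center_subset {P : ClosedIdeal A} (hP : P.IsPrimitive)
    (hmod : ¬ P.IsModular) : Set.center A ⊆ (P : Set A) := by
  obtain ⟨H, _, _, _, π, hπ, hker⟩ := hP
  have hsa : ∀ z ∈ Set.center A, IsSelfAdjoint z → z ∈ P := by
    intro z hz hzsa
    by_contra hzP
    rw [hker] at hzP
    -- By Schur `π z` is a scalar `r`; were `r` nonzero, `r⁻¹ z` would be an identity modulo `P`.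
    obtain ⟨r, hr⟩ := hπ.exists_eq_algebraMap (hzsa.map π) fun a => by
      rw [commute_iff_eq, ← map_mul, ← map_mul, mem_center_iff_forall.mp hz a]
    rw [Algebra.algebraMap_eq_smul_one, ← Complex.coe_smul] at hr
    have hr0 : (r : ℂ) ≠ 0 := by
      rintro h0
      rw [h0, zero_smul] at hr
      exact hzP hr
    refine hmod (isModular_iff.mpr ⟨(r : ℂ)⁻¹ • z, fun x => ⟨?_, ?_⟩⟩)
    · rw [hker, map_sub, map_mul, map_smul, hr, smul_smul, inv_mul_cancel₀ hr0, one_smul,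
        one_mul, sub_self]
    · rw [hker, map_sub, map_mul, map_smul, hr, smul_smul, inv_mul_cancel₀ hr0, one_smul,
        mul_one, sub_self]
  intro z hz
  have hz' : star z ∈ Set.center A := Set.star_mem_center hz
  have hmem : ∀ w ∈ NonUnitalStarSubalgebra.center ℂ A, IsSelfAdjoint w → w ∈ P :=
    fun w hw => hsa w hw
  have h1 : z + star z ∈ P :=
    hmem _ (add_mem (S := NonUnitalStarSubalgebra ℂ A) hz hz') (.add_star_self z)
  have h2 : Complex.I • (z - star z) ∈ P := by
    refine hmem _ (SMulMemClass.smul_mem _ (sub_mem (S := NonUnitalStarSubalgebra ℂ A) hz hz')) ?_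
    rw [IsSelfAdjoint, star_smul, star_sub, star_star, Complex.star_def, Complex.conj_I, neg_smul,
      ← smul_neg, neg_sub]
  have h3 : z = (2 : ℂ)⁻¹ • ((z + star z) - Complex.I • Complex.I • (z - star z)) := by
    rw [smul_smul, Complex.I_mul_I]
    module
  rw [h3]
  exact SMulMemClass.smul_mem (S := ClosedIdeal A) _
    (sub_mem (S := ClosedIdeal A) h1 (SMulMemClass.smul_mem _ h2))

end Schur

/-! ### The non-modular primitive ideals of a weakly central algebra -/

section Main

variable {A : Type u} [NonUnitalCStarAlgebra A]

open ClosedIdeal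

theorem IsWeaklyCentral.center_subset_iff (h : IsWeaklyCentral A) {P : ClosedIdeal A}
    (hP : P.IsPrimitive) : Set.center A ⊆ (P : Set A) ↔ ¬ P.IsModular := by
  refine ⟨fun hZ hmod => ?_, hP.center_subset⟩
  obtain ⟨e, he⟩ := isModular_iff.mp hmod
  obtain ⟨M, hM, hPM⟩ := he.exists_le_maximal hP.ne_top
  exact h.1 M hM fun z hz => hPM (hZ hz)

theorem isClosed_iff_exists_eq_hull {S : Set (PrimitiveSpectrum A)} :
    IsClosed S ↔ ∃ X : Set A, S = hull X := by
  rw [← isOpen_compl_iff]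
  change (∃ X : Set A, Sᶜᶜ = hull X) ↔ _
  rw [compl_compl]

theorem IsWeaklyCentral.nonModularPrimitives_eq (h : IsWeaklyCentral A) :
    nonModularPrimitives A = hull (Set.center A) :=
  Set.ext fun P => (h.center_subset_iff P.2).symm

theorem mem_idealJ {a : A} : a ∈ idealJ A ↔
    ∀ P : ClosedIdeal A, P.IsPrimitive → ¬ P.IsModular → a ∈ P := by
  constructor
  · exact fun h P hP hmod => h P ⟨⟨P, hP⟩, hmod, rfl⟩
  · rintro h _ ⟨P, hmod, rfl⟩
    exact h P.1 P.2 hmod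

theorem center_subset_idealK : Set.center A ⊆ (idealK A : Set A) :=
  fun _ hz _ hI => hI hz

theorem idealK_le {I : ClosedIdeal A} (h : Set.center A ⊆ (I : Set A)) : idealK A ≤ I :=
  fun _ ha => ha I h

/-- Both ideals are the intersection of the primitive ideals containing `Z(A)`. -/
theorem IsWeaklyCentral.idealJ_eq_idealK (h : IsWeaklyCentral A) : idealJ A = idealK A := by
  refine le_antisymm (fun a ha => ?_) (idealK_le fun z hz => mem_idealJ.mpr
    fun P hP hmod => hP.center_subset hmod hz)
  by_contra haK
  obtain ⟨P, hP, hKP, haP⟩ := exists_primitive_of_notMem haK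
  exact haP (mem_idealJ.mp ha P hP
    ((h.center_subset_iff hP).mp (center_subset_idealK.trans hKP)))

/-- This needs no weak centrality: an ideal of `K_A` containing `Z(K_A) = Z(A)` is an ideal of `A`
containing `Z(A)`, hence all of `K_A`. -/
theorem isQuasiCentral_idealK : IsQuasiCentral (idealK A) := by
  intro Q hQ hZ
  refine hQ.ne_top (eq_top_iff_forall.mpr fun x => coe_mem_extend.mp (idealK_le ?_ x.2))
  intro z hz
  have hzK := center_subset_idealK hz
  exact ⟨⟨z, hzK⟩, hZ (mem_center_ideal_iff.mpr hz), rfl⟩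

/-- Modular maximal ideals are primitive, so none contains `J`, and weak centrality of `J` controls
them all. -/
theorem isWeaklyCentral_of_forall_primitive (J : ClosedIdeal A) (hJ : IsWeaklyCentral J)
    (h : ∀ P : ClosedIdeal A, P.IsPrimitive → J ≤ P → ¬ P.IsModular) : IsWeaklyCentral A := by
  have hJM : ∀ M ∈ modularMaximalIdeals A, ¬ J ≤ M := fun M hM hle =>
    h M hM.1.isPrimitive hle hM.2
  refine ⟨fun M hM hZ => ?_, fun M hM N hN =>
    hJ.eq_of_inter_center_eq hM hN (hJM M hM) (hJM N hN)⟩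
  obtain ⟨z, hz, -, hzM⟩ := hJ.exists_center_notMem hM (hJM M hM)
  exact hzM (hZ hz)

theorem liftsCenter_bot : (⊥ : ClosedIdeal A).LiftsCenter := fun x hx =>
  ⟨x, mem_center_iff_forall.mpr fun b => sub_eq_zero.mp (mem_bot.mp (hx b)), by
    rw [sub_self]; exact zero_mem _⟩

end Main

/-! ### The equivalence of the five conditions -/

theorem mainTheorem1 (A : Type u) [NonUnitalCStarAlgebra A] :
    List.TFAE [
      HasCQ A,
      IsWeaklyCentral A,
      IsClosed (nonModularPrimitives A) ∧ idealJ A = idealK A ∧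
        IsQuasiCentral (idealJ A) ∧ IsWeaklyCentral (idealJ A),
      ∃ J : ClosedIdeal A, IsWeaklyCentral J ∧
        ∀ P : ClosedIdeal A, P.IsPrimitive → J ≤ P → ¬ P.IsModular,
      ∃ J : ClosedIdeal A, HasCQ J ∧ HasCQ J.Quotient ∧
        Set.center J.Quotient = J.proj '' Set.center A] := by
  tfae_have 1 → 2 := HasCQ.isWeaklyCentral
  tfae_have 2 → 1 := IsWeaklyCentral.hasCQ
  tfae_have 2 → 3 := fun h => by
    refine ⟨?_, h.idealJ_eq_idealK, ?_, (h.hasCQ.ideal _).isWeaklyCentral⟩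
    · rw [h.nonModularPrimitives_eq]
      exact isClosed_iff_exists_eq_hull.mpr ⟨_, rfl⟩
    · rw [h.idealJ_eq_idealK]
      exact isQuasiCentral_idealK
  tfae_have 3 → 4 := fun ⟨hcl, _, _, hwc⟩ => by
    refine ⟨idealJ A, hwc, fun P hP hJP => ?_⟩
    -- Closedness enters here: `S_A` is the hull of some `X ⊆ J_A`, so it contains every primitive
    -- ideal above `J_A`.
    obtain ⟨X, hX⟩ := isClosed_iff_exists_eq_hull.mp hcl
    have hP' : (⟨P, hP⟩ : PrimitiveSpectrum A) ∈ hull X := fun x hx =>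
      hJP (ClosedIdeal.mem_sInf.mpr (by
        rintro _ ⟨Q, hQ, rfl⟩
        rw [hX] at hQ
        exact hQ hx))
    rw [← hX] at hP'
    exact hP'
  tfae_have 4 → 2 := fun ⟨J, hJ, h⟩ => isWeaklyCentral_of_forall_primitive J hJ h
  tfae_have 1 → 5 := fun h =>
    ⟨⊥, h.ideal _, h.quotient _, ClosedIdeal.liftsCenter_iff.mp liftsCenter_bot⟩
  tfae_have 5 → 2 := fun ⟨J, hJ, hQ, hZ⟩ => isWeaklyCentral_of_extension J hJ hQ hZ
  tfae_finish
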